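/- A *trace* on a group $G$ is a function $\varphi:G\to\mathbb{C}$ that is positive-definite ($\sum_{i,j}\alpha_i\overline{\alpha_j}\,\varphi(g_j^{-1}g_i)\ge 0$ for all finite families $g_i\in G$, $\alpha_i\in\mathbb{C}$), conjugation-invariant and normalized by $\varphi(e)=1$. The space $\mathrm{Tr}(G)$ of traces is convex and carries the topology of pointwise convergence; its extreme points are the *characters*, and they form the set $\mathrm{Ch}(G)$. Let $G$ be a group with a finite generating set $S$, and let $\theta_n:G\to G_n$ $(n\in\mathbb{N})$ be a LEF approximation: the groups $G_n$ are finite, for all $g,h\in G$ one has $\theta_n(gh)=\theta_n(g)\theta_n(h)$ for all large $n$, and for all $g\ne e$ one has $\theta_n(g)\neq e$ for all large $n$. Assume that it is essential and by simple groups: the groups $G_n$ are simple and pairwise non-isomorphic, and for every $n$ the restriction $\theta_n|_S$ does not extend to a homomorphism $G\to G_n$ and $\theta_n(S)$ generates $G_n$. Let $\Gamma=\bigotimes G_n\le\prod_n G_n$ be the associated diagonal product, i.e. the subgroup generated by the elements $\gamma_s=(\theta_n(s))_n$, $s\in S$. Let $t:\Gamma\to G$ be the tail map, i.e. the homomorphism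 with $t(\gamma_s)=s$ for all $s\in S$; equivalently, $t(\gamma)$ is the unique $g\in G$ with $\gamma_n=\theta_n(g)$ for all large $n$. 1. The map $t$ is surjective, $\Gamma$ contains $U:=\bigoplus_n G_n$, and $\ker t=U$. The tensor product $(\varphi_n)_n\mapsto\bigotimes_n\varphi_n$, where $(\bigotimes_n\varphi_n)(u)=\prod_n\varphi_n(u_n)$, is a bijection $\prod_n\mathrm{Ch}(G_n)\to\mathrm{Ch}(U)$. For $\varphi=(\varphi_n)\in\prod_n\mathrm{Ch}(G_n)$, an element $\tau\in G$ is *null* for $\varphi$ if $\prod_{i}|\varphi_i(\gamma_i)|=0$ for every $\gamma\in\Gamma$ with $t(\gamma)=\tau$. A trace $\psi\in\mathrm{Tr}(G)$ is *compatible* with $\varphi$ if $\psi(\tau)=0$ for every $\tau$ that is null for $\varphi$. The extreme points of the convex set of compatible traces are the *compatible characters* for $\varphi$. An *auxiliary trace* for $\varphi$ is an accumulation point $\widehat\varphi$, for pointwise convergence on $\Gamma$, of the sequence of functions $\gamma\mapsto\prod_{i\le n}\varphi_i(\gamma_i)$. 2. Let $\varphi\in\prod_n\mathrm{Ch}(G_n)$.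 Auxiliary traces for $\varphi$ exist, each of them belongs to $\mathrm{Tr}(\Gamma)$, and for each of them the map $\psi\mapsto\widehat\varphi\cdot(\psi\circ t)$ is an affine homeomorphism $$\{\psi\in\mathrm{Tr}(G):\psi\text{ is compatible with }\varphi\}\;\cong\;\{\zeta\in\mathrm{Tr}(\Gamma):\zeta|_U=\textstyle\bigotimes_n\varphi_n\}.$$ It restricts to a homeomorphism of the set of compatible characters for $\varphi$ onto $\{\zeta\in\mathrm{Ch}(\Gamma):\zeta|_U=\bigotimes_n\varphi_n\}$. 3. Consequently, for any choice of an auxiliary trace $\widehat\varphi$ for each $\varphi\in\prod_n\mathrm{Ch}(G_n)$, the map $(\varphi,\psi)\mapsto\widehat\varphi\cdot(\psi\circ t)$ is a bijection $$\Big\{(\varphi,\psi)\in\prod_n\mathrm{Ch}(G_n)\times\mathrm{Tr}(G):\psi\text{ is a compatible character for }\varphi\Big\}\;\longrightarrow\;\mathrm{Ch}(\Gamma).$$ -/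

import Mathlib

open Filter Topology
open scoped ComplexOrder

noncomputable section

namespace DiagProd

universe u v

/-! ### Traces and characters of a group -/

section Traces

variable {G : Type u} [Group G]

/-- A trace on `G`: a positive-definite, normalized, conjugation-invariant function `G → ℂ`.
In `ℂ`, `0 ≤ z` means that `z` is a non-negative real number. -/
structure IsTrace (φ : G → ℂ) : Prop where
  posDef : ∀ (n : ℕ) (g : Fin n → G) (α : Fin n → ℂ),
    0 ≤ ∑ i, ∑ j, α i * (starRingEnd ℂ) (α j) * φ ((g j)⁻¹ * g i)
  normalized : φ 1 = 1
  conjInvariant : ∀ g h : G, φ (h⁻¹ * g * h) = φ g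

variable (G) in
/-- The space of traces on `G`, inside `G → ℂ` with the topology of pointwise convergence. -/
def Tr : Set (G → ℂ) := {φ | IsTrace φ}

variable (G) in
/-- The characters of `G`: the extreme points of the convex set of traces. -/
def Ch : Set (G → ℂ) := (Tr G).extremePoints ℝ

end Traces

/-- The linear map `f` restricts to a homeomorphism of `A` onto `B` (which is then affine on
convex subsets of `A`, being the restriction of a linear map). -/
def RestrictsToHomeomorph {X Y : Type*} [AddCommGroup X] [Module ℂ X] [TopologicalSpace X]
    [AddCommGroup Y] [Module ℂ Y] [TopologicalSpace Y]
    (f : X →ₗ[ℂ] Y) (A : Set X) (B : Set Y) : Prop :=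
  ∃ F : A ≃ₜ B, ∀ x : A, (F x : Y) = f x

/-! ### LEF approximations and diagonal products -/

section Diagonal

variable {G : Type u} [Group G] {H : ℕ → Type v} [∀ n, Group (H n)]

/-- `θ n : G → H n` is a LEF approximation: the groups `H n` are finite, the maps are eventually
multiplicative on each pair of elements, and eventually non-trivial on each `g ≠ 1`. -/
structure IsLEFApprox (θ : ∀ n, G → H n) : Prop where
  finite : ∀ n, Finite (H n)
  eventually_mul : ∀ g h : G, ∀ᶠ n in atTop, θ n (g * h) = θ n g * θ n h
  eventually_ne_one : ∀ g : G, g ≠ 1 → ∀ᶠ n in atTop, θ n g ≠ 1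

/-- The additional conditions for a LEF approximation to be essential and by simple groups, with
respect to the generating set `S`. -/
structure IsEssentialBySimple (S : Set G) (θ : ∀ n, G → H n) : Prop where
  simple : ∀ n, IsSimpleGroup (H n)
  pairwise_not_iso : ∀ m n, m ≠ n → IsEmpty (H m ≃* H n)
  not_extend : ∀ n, ¬ ∃ f : G →* H n, ∀ s ∈ S, f s = θ n s
  generates : ∀ n, Subgroup.closure (θ n '' S) = ⊤

/-- The diagonal product: the subgroup of `∏ H n` generated by the elements `(θ n s)_n`, `s ∈ S`. -/
def diagonalProduct (S : Set G) (θ : ∀ n, G → H n) : Subgroup (∀ n, H n) :=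
  Subgroup.closure ((fun s n => θ n s) '' S)

variable (H) in
/-- The direct sum `⊕ H n`, as a subgroup of the direct product `∏ H n`. -/
def directSum : Subgroup (∀ n, H n) where
  carrier := {f | {n | f n ≠ 1}.Finite}
  one_mem' := by simp
  mul_mem' {a b} ha hb := by
    refine (Set.Finite.union ha hb).subset fun n hn => ?_
    by_contra h
    have h1 : a n = 1 := by
      by_contra h'
      exact h (Or.inl h')
    have h2 : b n = 1 := by
      by_contra h'
      exact h (Or.inr h')
    exact hn (by simp [h1, h2])
  inv_mem' {a} ha := by simpa using ha

/-- The direct sum `⊕ H n`, seen as a subgroup of the diagonal product. -/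
def sumSubgroup (S : Set G) (θ : ∀ n, G → H n) : Subgroup (diagonalProduct S θ) :=
  (directSum H).subgroupOf (diagonalProduct S θ)

namespace IsLEFApprox

variable {θ : ∀ n, G → H n}

theorem eventually_one (hθ : IsLEFApprox θ) : ∀ᶠ n in atTop, θ n 1 = 1 := by
  filter_upwards [hθ.eventually_mul 1 1] with n hn
  simpa using hn

theorem eventually_inv (hθ : IsLEFApprox θ) (g : G) :
    ∀ᶠ n in atTop, θ n g⁻¹ = (θ n g)⁻¹ := by
  filter_upwards [hθ.eventually_mul g⁻¹ g, hθ.eventually_one] with n hn h1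
  rw [inv_mul_cancel, h1] at hn
  exact eq_inv_of_mul_eq_one_left hn.symm

theorem eq_of_eventually_eq (hθ : IsLEFApprox θ) {g h : G}
    (e : ∀ᶠ n in atTop, θ n g = θ n h) : g = h := by
  by_contra hne
  have h1 : g * h⁻¹ ≠ 1 := fun h' => hne (mul_inv_eq_one.mp h')
  obtain ⟨n, hn1, hn2, hn3, hn4⟩ := (e.and ((hθ.eventually_ne_one _ h1).and
    ((hθ.eventually_mul g h⁻¹).and (hθ.eventually_inv h)))).exists
  exact hn2 (by rw [hn3, hn4, hn1, mul_inv_cancel])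

theorem exists_tail (hθ : IsLEFApprox θ) (S : Set G) (γ : diagonalProduct S θ) :
    ∃ g : G, ∀ᶠ n in atTop, (γ : ∀ n, H n) n = θ n g := by
  obtain ⟨γ, hγ⟩ := γ
  induction hγ using Subgroup.closure_induction with
  | mem x hx =>
    obtain ⟨s, -, rfl⟩ := hx
    exact ⟨s, Eventually.of_forall fun _ => rfl⟩
  | one =>
    refine ⟨1, ?_⟩
    filter_upwards [hθ.eventually_one] with n hn
    simp [hn]
  | mul x y _ _ hx hy =>
    obtain ⟨g, hg⟩ := hx
    obtain ⟨h, hh⟩ := hy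
    refine ⟨g * h, ?_⟩
    filter_upwards [hg, hh, hθ.eventually_mul g h] with n h1 h2 h3
    simp [h1, h2, h3]
  | inv x _ hx =>
    obtain ⟨g, hg⟩ := hx
    refine ⟨g⁻¹, ?_⟩
    filter_upwards [hg, hθ.eventually_inv g] with n h1 h2
    simp [h1, h2]

/-- The tail map `t : ⊗ H n → G`: it sends `γ` to the unique `g ∈ G` such that `γ n = θ n g` for
all sufficiently large `n`. It is the homomorphism with `t ((θ n s)_n) = s` for all `s ∈ S`. -/
def tailMap (hθ : IsLEFApprox θ) (S : Set G) : diagonalProduct S θ →* G where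
  toFun γ := (hθ.exists_tail S γ).choose
  map_one' := by
    refine hθ.eq_of_eventually_eq ?_
    filter_upwards [(hθ.exists_tail S 1).choose_spec, hθ.eventually_one] with n h1 h2
    rw [← h1, h2]
    rfl
  map_mul' x y := by
    refine hθ.eq_of_eventually_eq ?_
    filter_upwards [(hθ.exists_tail S (x * y)).choose_spec, (hθ.exists_tail S x).choose_spec,
      (hθ.exists_tail S y).choose_spec, hθ.eventually_mul (hθ.exists_tail S x).choose
      (hθ.exists_tail S y).choose] with n h1 h2 h3 h4
    rw [← h1, h4, ← h2, ← h3]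
    rfl

theorem tailMap_spec (hθ : IsLEFApprox θ) (S : Set G) (γ : diagonalProduct S θ) :
    ∀ᶠ n in atTop, (γ : ∀ n, H n) n = θ n (hθ.tailMap S γ) :=
  (hθ.exists_tail S γ).choose_spec

theorem tailMap_generator (hθ : IsLEFApprox θ) (S : Set G) {s : G} (hs : s ∈ S) :
    hθ.tailMap S ⟨fun n => θ n s, Subgroup.subset_closure ⟨s, hs, rfl⟩⟩ = s :=
  (hθ.eq_of_eventually_eq (hθ.tailMap_spec S
    ⟨fun n => θ n s, Subgroup.subset_closure ⟨s, hs, rfl⟩⟩)).symm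

end IsLEFApprox

/-! ### Tensor products, compatible traces and compatible characters -/

variable (S : Set G) (θ : ∀ n, G → H n)

/-- The tensor product `⊗ φ n` on `U = ⊕ H n`: the function `u ↦ ∏ n, φ n (u n)`. When `φ n 1 = 1`
for all `n`, all but finitely many factors are equal to `1`. -/
def tensor (φ : ∀ n, H n → ℂ) : sumSubgroup S θ → ℂ :=
  fun u => ∏ᶠ n, φ n (((u : diagonalProduct S θ) : ∀ n, H n) n)

/-- The function `γ ↦ ∏ i < n, φ i (γ i)` on the diagonal product. -/
def partialTensor (φ : ∀ n, H n → ℂ) (n : ℕ) : diagonalProduct S θ → ℂ :=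
  fun γ => ∏ i ∈ Finset.range n, φ i ((γ : ∀ n, H n) i)

/-- `φhat` is an accumulation point, for pointwise convergence, of the sequence of functions
`γ ↦ ∏ i < n, φ i (γ i)`. -/
def IsAuxiliary (φ : ∀ n, H n → ℂ) (φhat : diagonalProduct S θ → ℂ) : Prop :=
  MapClusterPt φhat atTop (partialTensor S θ φ)

/-- The traces on the diagonal product whose restriction to `U = ⊕ H n` is `⊗ φ n`. -/
def tracesOver (φ : ∀ n, H n → ℂ) : Set (diagonalProduct S θ → ℂ) :=
  {ζ | ζ ∈ Tr (diagonalProduct S θ) ∧ (fun u : sumSubgroup S θ => ζ u) = tensor S θ φ}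

variable {θ}

/-- `τ ∈ G` is null for `φ` if the infinite product `∏ |φ i (γ i)|` (the limit of its partial
products) is `0` for every `γ` in the diagonal product with tail `τ`. -/
def IsNull (hθ : IsLEFApprox θ) (φ : ∀ n, H n → ℂ) (τ : G) : Prop :=
  ∀ γ : diagonalProduct S θ, hθ.tailMap S γ = τ →
    Tendsto (fun n => ∏ i ∈ Finset.range n, ‖φ i ((γ : ∀ n, H n) i)‖) atTop (𝓝 0)

/-- The traces on `G` that are compatible with `φ`. -/
def compatibleTraces (hθ : IsLEFApprox θ) (φ : ∀ n, H n → ℂ) : Set (G → ℂ) :=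
  {ψ | ψ ∈ Tr G ∧ ∀ τ, IsNull S hθ φ τ → ψ τ = 0}

/-- The compatible characters for `φ`: the extreme points of the set of compatible traces. -/
def compatibleCharacters (hθ : IsLEFApprox θ) (φ : ∀ n, H n → ℂ) : Set (G → ℂ) :=
  (compatibleTraces S hθ φ).extremePoints ℝ

/-- The linear map `ψ ↦ φhat · (ψ ∘ t)`. -/
def twist (hθ : IsLEFApprox θ) (φhat : diagonalProduct S θ → ℂ) :
    (G → ℂ) →ₗ[ℂ] (diagonalProduct S θ → ℂ) where
  toFun ψ := fun γ => φhat γ * ψ (hθ.tailMap S γ)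
  map_add' ψ₁ ψ₂ := by
    funext γ
    simp [mul_add]
  map_smul' c ψ := by
    funext γ
    simp [mul_left_comm]

end Diagonal

end DiagProd

end

/-! Structure of Γ. Since θₙ|S does not extend to G, evaluation at n cannot factor through t, so
some element of Γ ∩ U is nontrivial at n. Minimising its support and arguing as in Goursat's lemma,
with simple, pairwise non-isomorphic factors, leaves an element supported at n alone. The elements
of Gₙ lying in Γ form a normal subgroup, hence all of Gₙ (`directSum_le`).

Splitting off coordinates. A character is multiplicative against central elements of the group
algebra (`character_sum_mul`). On a finite group K this says that the centred class sum z = ∑ₖ k⁻¹xk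
− |K|φ(x) satisfies φ(z*z) = 0. Degenerate Cauchy–Schwarz then gives ζ(xg) = ζ(x)ζ(g) for every
trace ζ restricting to the character φ on K and every g commuting with K. With eₙγ denoting γ with
its first n coordinates erased, a trace ζ restricting to φᵢ on each factor thus satisfies ζ(γ) =
∏_{i<n} φᵢ(γᵢ) · ζ(eₙγ) (`eq_partialProd_mul`). On U this yields the description of Ch(U).

Inverting the twist. The moduli of the partial products decrease to |φ̂(γ)|, for every auxiliary
trace φ̂. Hence |ζ| ≤ |φ̂|, and if φ̂(γ) ≠ 0 then |φ̂(eₙγ)| → 1, so that ζ(eₙγ)·conj φ̂(eₙγ) →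
ζ(γ)/φ̂(γ). The limit depends only on t(γ). As a limit of the trace ζ·conj φ̂ along the
homomorphisms eₙ, it defines a trace ψ on G with ζ = φ̂·(ψ∘t) (`exists_twist_eq`). Compactness makes
the twist a homeomorphism. Traces over ⊗φₙ form a face of Tr(Γ), so extreme points correspond to
characters of Γ. -/

open Filter Topology
open scoped ComplexOrder

noncomputable section

namespace DiagProd

/-! ### Positive-definite functions -/

section PosDef

variable {G : Type*} [Group G]

/-- Positive-definite functions on a group. -/
def IsPosDef (f : G → ℂ) : Prop :=
  ∀ (n : ℕ) (g : Fin n → G) (α : Fin n → ℂ),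
    0 ≤ ∑ i, ∑ j, α i * (starRingEnd ℂ) (α j) * f ((g j)⁻¹ * g i)

theorem IsPosDef.sum_nonneg {f : G → ℂ} (hf : IsPosDef f) {ι : Type*} [Fintype ι]
    (g : ι → G) (α : ι → ℂ) :
    0 ≤ ∑ i, ∑ j, α i * (starRingEnd ℂ) (α j) * f ((g j)⁻¹ * g i) := by
  let e := Fintype.equivFin ι
  have h := hf (Fintype.card ι) (g ∘ e.symm) (α ∘ e.symm)
  rw [← e.symm.sum_comp]
  simp_rw [← e.symm.sum_comp (fun j => α _ * (starRingEnd ℂ) (α j) * f ((g j)⁻¹ * g _))]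
  exact h

theorem IsPosDef.quadratic_nonneg {f : G → ℂ} (hf : IsPosDef f) {ι : Type*} [Fintype ι]
    (g : ι → G) (α : ι → ℂ) (h : G) (c : ℂ) :
    0 ≤ (∑ i, ∑ j, α i * (starRingEnd ℂ) (α j) * f ((g j)⁻¹ * g i)) +
      (starRingEnd ℂ) c * (∑ i, α i * f (h⁻¹ * g i)) +
      c * (∑ i, (starRingEnd ℂ) (α i) * f ((g i)⁻¹ * h)) + c * (starRingEnd ℂ) c * f 1 := by
  have := hf.sum_nonneg (fun o : Option ι => o.elim h g) (fun o => o.elim c α)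
  simp only [Fintype.sum_option, Option.elim, inv_mul_cancel] at this
  convert this using 1
  rw [Finset.sum_add_distrib, Finset.mul_sum, Finset.mul_sum]
  have h1 : ∀ i, (starRingEnd ℂ) c * (α i * f (h⁻¹ * g i)) =
      α i * (starRingEnd ℂ) c * f (h⁻¹ * g i) := fun i => by ring
  have h2 : ∀ i, c * ((starRingEnd ℂ) (α i) * f ((g i)⁻¹ * h)) =
      c * (starRingEnd ℂ) (α i) * f ((g i)⁻¹ * h) := fun i => by ring
  simp_rw [h1, h2]
  ring

theorem IsPosDef.one_nonneg {f : G → ℂ} (hf : IsPosDef f) : 0 ≤ f 1 := by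
  simpa using hf.sum_nonneg (fun _ : Unit => (1 : G)) (fun _ => 1)

theorem IsPosDef.map_inv {f : G → ℂ} (hf : IsPosDef f) (g : G) :
    f g⁻¹ = (starRingEnd ℂ) (f g) := by
  have h0 := (Complex.nonneg_iff.mp hf.one_nonneg).2
  -- The forms at g + 1 and g + i·1 are real, which determines both parts of `f g⁻¹`.
  have h1 := (Complex.nonneg_iff.mp
    (hf.quadratic_nonneg (fun _ : Unit => g) (fun _ => 1) 1 1)).2
  have h2 := (Complex.nonneg_iff.mp
    (hf.quadratic_nonneg (fun _ : Unit => g) (fun _ => 1) 1 Complex.I)).2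
  simp at h1 h2
  apply Complex.ext <;> simp <;> linarith

/-- The Cauchy–Schwarz inequality in the degenerate case. -/
theorem IsPosDef.sum_eq_zero {f : G → ℂ} (hf : IsPosDef f) {ι : Type*} [Fintype ι]
    (g : ι → G) (α : ι → ℂ)
    (h0 : ∑ i, ∑ j, α i * (starRingEnd ℂ) (α j) * f ((g j)⁻¹ * g i) = 0) (h : G) :
    ∑ i, α i * f (h⁻¹ * g i) = 0 := by
  set w := ∑ i, α i * f (h⁻¹ * g i) with hw
  have hw' : ∑ i, (starRingEnd ℂ) (α i) * f ((g i)⁻¹ * h) = (starRingEnd ℂ) w := by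
    rw [hw, map_sum]
    refine Finset.sum_congr rfl fun i _ => ?_
    rw [map_mul, ← hf.map_inv, mul_inv_rev, inv_inv]
  have hf1 := Complex.nonneg_iff.mp hf.one_nonneg
  -- With coefficient −rw at `h`, the form equals −(r + r²)|w|². The summand 1 in the denominator
  -- covers the case `f 1 = 0`.
  set r : ℝ := 1 / (1 + (f 1).re) with hr
  have hpos : 0 < 1 + (f 1).re := by linarith [hf1.1]
  have key := hf.quadratic_nonneg g α h (-(r : ℂ) * w)
  rw [h0, hw', ← hw] at key
  have e : f 1 = ((f 1).re : ℂ) := Complex.ext (by simp) (by simpa using hf1.2.symm)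
  rw [e] at key
  have e2 : 0 + (starRingEnd ℂ) (-(r : ℂ) * w) * w + -(r : ℂ) * w * (starRingEnd ℂ) w +
      -(r : ℂ) * w * (starRingEnd ℂ) (-(r : ℂ) * w) * ((f 1).re : ℂ) =
      ((-(2 * r - r * r * (f 1).re) * Complex.normSq w : ℝ) : ℂ) := by
    push_cast
    rw [← Complex.mul_conj]
    simp only [map_mul, map_neg, Complex.conj_ofReal]
    ring
  rw [e2] at key
  have key' : 0 ≤ -(2 * r - r * r * (f 1).re) * Complex.normSq w := by exact_mod_cast key
  have hrpos : 0 < r := by positivity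
  have hr1 : r * (1 + (f 1).re) = 1 := by rw [hr]; field_simp
  have : 2 * r - r * r * (f 1).re = r + r * r := by
    have : r * r * (f 1).re = r * (r * (1 + (f 1).re)) - r * r := by ring
    rw [this, hr1]; ring
  rw [this] at key'
  have h3 : 0 < r + r * r := by positivity
  have h4 := Complex.normSq_nonneg w
  have : Complex.normSq w = 0 := by nlinarith
  exact Complex.normSq_eq_zero.mp this

theorem IsPosDef.eq_zero_of_one {f : G → ℂ} (hf : IsPosDef f) (h1 : f 1 = 0) (g : G) :
    f g = 0 := by
  simpa using hf.sum_eq_zero (fun _ : Unit => g) (fun _ => 1) (by simpa using h1) 1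

theorem IsPosDef.norm_le_one {f : G → ℂ} (hf : IsPosDef f) (h1 : f 1 = 1) (g : G) :
    ‖f g‖ ≤ 1 := by
  -- The form at g − f(g)·1 is 1 − |f(g)|².
  have key := hf.quadratic_nonneg (fun _ : Unit => g) (fun _ => 1) 1 (-f g)
  have hi : f (g⁻¹ * 1) = (starRingEnd ℂ) (f g) := by rw [mul_one, hf.map_inv]
  simp only [Finset.univ_unique, Finset.sum_singleton, hi, h1] at key
  have e : (1 : ℂ) * (starRingEnd ℂ) 1 * f (g⁻¹ * g) + (starRingEnd ℂ) (-f g) * (1 * f (1⁻¹ * g)) +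
      -f g * ((starRingEnd ℂ) 1 * (starRingEnd ℂ) (f g)) + -f g * (starRingEnd ℂ) (-f g) * 1 =
      ((1 - ‖f g‖ ^ 2 : ℝ) : ℂ) := by
    push_cast
    rw [← Complex.mul_conj']
    simp [h1]
    ring
  rw [e] at key
  have key' : 0 ≤ 1 - ‖f g‖ ^ 2 := by exact_mod_cast key
  nlinarith [norm_nonneg (f g)]

theorem IsPosDef.posSemidef {f : G → ℂ} (hf : IsPosDef f) {n : ℕ} (g : Fin n → G) :
    (Matrix.of fun j i => f ((g j)⁻¹ * g i)).PosSemidef := by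
  refine Matrix.PosSemidef.of_dotProduct_mulVec_nonneg ?_ fun x => ?_
  · ext i j
    simp only [Matrix.conjTranspose_apply, Matrix.of_apply, RCLike.star_def]
    rw [← hf.map_inv]
    simp
  · have := hf n g x
    convert this using 1
    simp only [dotProduct, Matrix.mulVec, Matrix.of_apply, Finset.mul_sum]
    rw [Finset.sum_comm]
    refine Finset.sum_congr rfl fun i _ => Finset.sum_congr rfl fun j _ => ?_
    simp only [Pi.star_apply, RCLike.star_def]
    ring

/-- Schur product theorem for the Gram matrices. -/
theorem IsPosDef.mul {f₁ f₂ : G → ℂ} (h₁ : IsPosDef f₁) (h₂ : IsPosDef f₂) :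
    IsPosDef fun g => f₁ g * f₂ g := by
  intro n g α
  have := ((h₁.posSemidef g).hadamard (h₂.posSemidef g)).dotProduct_mulVec_nonneg α
  convert this using 1
  simp only [dotProduct, Matrix.mulVec, Matrix.hadamard_apply, Matrix.of_apply, Finset.mul_sum]
  rw [Finset.sum_comm]
  refine Finset.sum_congr rfl fun i _ => Finset.sum_congr rfl fun j _ => ?_
  simp only [Pi.star_apply, RCLike.star_def]
  ring

theorem IsPosDef.conj {f : G → ℂ} (hf : IsPosDef f) :
    IsPosDef fun g => (starRingEnd ℂ) (f g) := by
  intro n g α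
  convert hf n g (fun i => (starRingEnd ℂ) (α i)) using 1
  rw [Finset.sum_comm]
  refine Finset.sum_congr rfl fun i _ => Finset.sum_congr rfl fun j _ => ?_
  beta_reduce
  rw [← hf.map_inv, mul_inv_rev, inv_inv, Complex.conj_conj]
  ring

theorem IsPosDef.comp {K : Type*} [Group K] {f : G → ℂ} (hf : IsPosDef f) (ι : K →* G) :
    IsPosDef fun k => f (ι k) := by
  intro n g α
  simpa using hf n (ι ∘ g) α

theorem IsPosDef.const_mul {f : G → ℂ} (hf : IsPosDef f) {c : ℂ} (hc : 0 ≤ c) :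
    IsPosDef fun g => c * f g := by
  intro n g α
  convert mul_nonneg hc (hf n g α) using 1
  simp only [Finset.mul_sum]
  refine Finset.sum_congr rfl fun i _ => Finset.sum_congr rfl fun j _ => by ring

end PosDef

/-! ### Operations on traces -/

section TraceOps

variable {G : Type*} [Group G]

namespace IsTrace

variable {f f₁ f₂ : G → ℂ}

theorem isPosDef (hf : IsTrace f) : IsPosDef f := hf.posDef

theorem norm_le_one (hf : IsTrace f) (g : G) : ‖f g‖ ≤ 1 :=
  hf.isPosDef.norm_le_one hf.normalized g

theorem mul (h₁ : IsTrace f₁) (h₂ : IsTrace f₂) : IsTrace fun g => f₁ g * f₂ g where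
  posDef := h₁.isPosDef.mul h₂.isPosDef
  normalized := by simp [h₁.normalized, h₂.normalized]
  conjInvariant g h := by simp [h₁.conjInvariant, h₂.conjInvariant]

theorem conj (hf : IsTrace f) : IsTrace fun g => (starRingEnd ℂ) (f g) where
  posDef := hf.isPosDef.conj
  normalized := by simp [hf.normalized]
  conjInvariant g h := by simp [hf.conjInvariant]

theorem comp {K : Type*} [Group K] (hf : IsTrace f) (ι : K →* G) :
    IsTrace fun k => f (ι k) where
  posDef := hf.isPosDef.comp ι
  normalized := by simp [hf.normalized]
  conjInvariant g h := by simp [hf.conjInvariant]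

theorem one : IsTrace fun _ : G => (1 : ℂ) where
  posDef n g α := by
    have : ∑ i, ∑ j, α i * (starRingEnd ℂ) (α j) * 1 =
        (∑ i, α i) * (starRingEnd ℂ) (∑ i, α i) := by
      rw [map_sum, Finset.sum_mul_sum]; simp
    rw [this]
    exact mul_star_self_nonneg _
  normalized := rfl
  conjInvariant _ _ := rfl

theorem prod {ι : Type*} (s : Finset ι) {f : ι → G → ℂ} (hf : ∀ i ∈ s, IsTrace (f i)) :
    IsTrace fun g => ∏ i ∈ s, f i g := by
  classical
  induction s using Finset.induction_on with
  | empty => simpa using one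
  | insert a s ha ih =>
    simp_rw [Finset.prod_insert ha]
    exact (hf a (by simp)).mul (ih fun i hi => hf i (by simp [hi]))

theorem map_mul_comm (hf : IsTrace f) (g h : G) : f (g * h) = f (h * g) := by
  simpa [mul_assoc] using (hf.conjInvariant (g * h) g).symm

end IsTrace

theorem isClosed_Tr : IsClosed (Tr G) := by
  have : Tr G = {φ | ∀ (n : ℕ) (g : Fin n → G) (α : Fin n → ℂ),
      0 ≤ ∑ i, ∑ j, α i * (starRingEnd ℂ) (α j) * φ ((g j)⁻¹ * g i)} ∩ {φ | φ 1 = 1} ∩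
      {φ | ∀ g h : G, φ (h⁻¹ * g * h) = φ g} := by
    ext φ
    exact ⟨fun h => ⟨⟨h.posDef, h.normalized⟩, h.conjInvariant⟩, fun h => ⟨h.1.1, h.1.2, h.2⟩⟩
  rw [this]
  refine (IsClosed.inter ?_ ?_).inter ?_
  · simp only [Set.ofPred_forall]
    exact isClosed_iInter fun n => isClosed_iInter fun g => isClosed_iInter fun α =>
      isClosed_le continuous_const (by fun_prop)
  · exact isClosed_eq (by fun_prop) continuous_const
  · simp only [Set.ofPred_forall]
    exact isClosed_iInter fun g => isClosed_iInter fun h => isClosed_eq (by fun_prop) (by fun_prop)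

theorem isCompact_Tr : IsCompact (Tr G) := by
  refine (isCompact_univ_pi fun _ : G => isCompact_closedBall (0 : ℂ) 1).of_isClosed_subset
    isClosed_Tr fun φ hφ g _ => ?_
  simpa using IsTrace.norm_le_one hφ g

theorem Ch_subset_Tr : Ch G ⊆ Tr G := extremePoints_subset

/-- A positive conjugation-invariant summand of a character is a multiple of it. -/
theorem eq_smul_of_add_eq_character {ζ f₁ f₂ : G → ℂ} (hζ : ζ ∈ Ch G)
    (h₁ : IsPosDef f₁) (h₂ : IsPosDef f₂)
    (c₁ : ∀ g h, f₁ (h⁻¹ * g * h) = f₁ g) (c₂ : ∀ g h, f₂ (h⁻¹ * g * h) = f₂ g)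
    (hadd : ∀ g, f₁ g + f₂ g = ζ g) (g : G) : f₁ g = f₁ 1 * ζ g := by
  have hζ1 : ζ 1 = 1 := (Ch_subset_Tr hζ).normalized
  have s := hadd 1
  rw [hζ1] at s
  rcases eq_or_ne (f₁ 1) 0 with e₁ | e₁
  · rw [e₁, h₁.eq_zero_of_one e₁, zero_mul]
  rcases eq_or_ne (f₂ 1) 0 with e₂ | e₂
  · rw [e₂, add_zero] at s
    rw [s, ← hadd g, h₂.eq_zero_of_one e₂, add_zero, one_mul]
  -- Both summands being nonzero at 1, their normalisations are traces, and `ζ` is the convex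
  -- combination of these with weights `f₁ 1` and `f₂ 1`.
  have normTrace : ∀ f : G → ℂ, IsPosDef f → (∀ g h, f (h⁻¹ * g * h) = f g) → f 1 ≠ 0 →
      (fun g => (f 1)⁻¹ * f g) ∈ Tr G := fun f hf cf e =>
    { posDef := hf.const_mul (inv_nonneg.mpr hf.one_nonneg)
      normalized := inv_mul_cancel₀ e
      conjInvariant := fun g h => by simp only [cf] }
  have real : ∀ f : G → ℂ, IsPosDef f → ((f 1).re : ℂ) = f 1 := fun f hf =>
    (Complex.ext (by simp) (by simpa using (Complex.nonneg_iff.mp hf.one_nonneg).2))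
  have pos : ∀ f : G → ℂ, IsPosDef f → f 1 ≠ 0 → 0 < (f 1).re := fun f hf e =>
    lt_of_le_of_ne (Complex.nonneg_iff.mp hf.one_nonneg).1 fun h0 => e (by
      rw [← real f hf, ← h0, Complex.ofReal_zero])
  have hseg : ζ ∈ openSegment ℝ (fun g => (f₁ 1)⁻¹ * f₁ g) (fun g => (f₂ 1)⁻¹ * f₂ g) := by
    refine ⟨(f₁ 1).re, (f₂ 1).re, pos _ h₁ e₁, pos _ h₂ e₂, ?_, ?_⟩
    · simpa using congrArg Complex.re s
    · funext g
      simp only [Pi.add_apply, Pi.smul_apply, Complex.real_smul]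
      rw [real _ h₁, real _ h₂, mul_inv_cancel_left₀ e₁, mul_inv_cancel_left₀ e₂, hadd]
  have := hζ.2 (normTrace f₁ h₁ c₁ e₁) (normTrace f₂ h₂ c₂ e₂) hseg
  rw [← congrFun this g, mul_inv_cancel_left₀ e₁]

end TraceOps

/-! ### Characters and finite families permuted by conjugation -/

section Central

variable {G : Type*} [Group G]

/-- Positivity of `(1 + ω x)⋆ (1 + ω x)` for a unimodular `ω`. -/
theorem IsPosDef.sum_pair_nonneg {f : G → ℂ} (hf : IsPosDef f) (x : G) {ω : ℂ}
    (hω : ω * (starRingEnd ℂ) ω = 1) {n : ℕ} (g : Fin n → G) (α : Fin n → ℂ) :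
    0 ≤ ∑ i, ∑ j, α i * (starRingEnd ℂ) (α j) * (2 * f ((g j)⁻¹ * g i) +
      ω * f ((g j)⁻¹ * (x * g i)) + (starRingEnd ℂ) ω * f ((g j)⁻¹ * (x⁻¹ * g i))) := by
  have := hf.sum_nonneg (Sum.elim g fun i => x * g i) (Sum.elim α fun i => ω * α i)
  convert this using 1
  simp only [Fintype.sum_sum_type, Sum.elim_inl, Sum.elim_inr, ← Finset.sum_add_distrib]
  refine Finset.sum_congr rfl fun i _ => Finset.sum_congr rfl fun j _ => ?_
  simp only [map_mul, mul_inv_rev, mul_assoc, inv_mul_cancel_left]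
  linear_combination (-α i * (starRingEnd ℂ) (α j) * f ((g j)⁻¹ * g i)) * hω

/-- Centrality of ∑ c k: conjugating by `h` only permutes the terms. `F` takes both the `c k` and
the `(c k)⁻¹` expression because the same permutation serves the two. -/
theorem sum_mul_inv_mul_eq {K : Type*} [Fintype K] {c : K → G}
    (hc : ∀ g, ∃ σ : Equiv.Perm K, ∀ k, g⁻¹ * c k * g = c (σ k)) (F : G → G → ℂ) (h g : G) :
    ∑ k, F (c k * (h⁻¹ * g)) ((c k)⁻¹ * (h⁻¹ * g)) =
      ∑ k, F (h⁻¹ * (c k * g)) (h⁻¹ * ((c k)⁻¹ * g)) := by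
  obtain ⟨σ, hσ⟩ := hc h
  rw [← Equiv.sum_comp σ (fun k => F (c k * (h⁻¹ * g)) ((c k)⁻¹ * (h⁻¹ * g)))]
  refine Finset.sum_congr rfl fun k _ => ?_
  rw [← hσ]
  congr 1 <;> group

/-- Characters are multiplicative with respect to finite families that are permuted by conjugation,
that is, with respect to central elements of the group algebra. -/
theorem character_sum_mul {ζ : G → ℂ} (hζ : ζ ∈ Ch G) {K : Type*} [Fintype K] (c : K → G)
    (hc : ∀ g, ∃ σ : Equiv.Perm K, ∀ k, g⁻¹ * c k * g = c (σ k)) (g : G) :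
    ∑ k, ζ (c k * g) = (∑ k, ζ (c k)) * ζ g := by
  rcases isEmpty_or_nonempty K with hK | hK
  · simp
  have hT : IsTrace ζ := Ch_subset_Tr hζ
  set M : ℂ := (Fintype.card K : ℂ) with hM
  have hM0 : M ≠ 0 := by simp [hM]
  have hMpos : 0 ≤ (4 * M)⁻¹ := by
    rw [hM]
    exact inv_nonneg.mpr (by positivity)
  -- T ω is ζ multiplied by the central positive element ∑ₖ (1 + ω cₖ)*(1 + ω cₖ). As T ω + T(−ω) =
  -- 4Mζ, extremality makes T ω a multiple of ζ.
  let T : ℂ → G → ℂ := fun ω g => ∑ k,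
    (2 * ζ g + ω * ζ (c k * g) + (starRingEnd ℂ) ω * ζ ((c k)⁻¹ * g))
  have hshift : ∀ ω h g, T ω (h⁻¹ * g) = ∑ k, (2 * ζ (h⁻¹ * g) + ω * ζ (h⁻¹ * (c k * g)) +
      (starRingEnd ℂ) ω * ζ (h⁻¹ * ((c k)⁻¹ * g))) := fun ω h g =>
    sum_mul_inv_mul_eq hc (fun a b => 2 * ζ (h⁻¹ * g) + ω * ζ a + (starRingEnd ℂ) ω * ζ b) h g
  have hpos : ∀ ω, ω * (starRingEnd ℂ) ω = 1 → IsPosDef (T ω) := by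
    intro ω hω n g α
    simp only [hshift, Finset.mul_sum]
    simp_rw [Finset.sum_comm (s := Finset.univ (α := Fin n)) (t := Finset.univ (α := K))]
    exact Finset.sum_nonneg fun k _ => hT.isPosDef.sum_pair_nonneg (c k) hω g α
  have hconj : ∀ ω g h, T ω (h⁻¹ * g * h) = T ω g := by
    intro ω g h
    rw [mul_assoc, hshift]
    refine Finset.sum_congr rfl fun k _ => ?_
    simp only [← mul_assoc]
    rw [hT.conjInvariant, mul_assoc h⁻¹, hT.conjInvariant, mul_assoc h⁻¹, hT.conjInvariant]
  have hadd : ∀ ω g, (4 * M)⁻¹ * T ω g + (4 * M)⁻¹ * T (-ω) g = ζ g := by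
    intro ω g
    have : T ω g + T (-ω) g = 4 * M * ζ g := by
      simp only [T, ← Finset.sum_add_distrib]
      rw [Finset.sum_congr rfl (g := fun _ => 4 * ζ g) fun k _ => by simp only [map_neg]; ring]
      simp [hM]
      ring
    rw [← mul_add, this, inv_mul_cancel_left₀ (by simp [hM0])]
  have hmul : ∀ ω, ω * (starRingEnd ℂ) ω = 1 → T ω g = T ω 1 * ζ g := by
    intro ω hω
    have := eq_smul_of_add_eq_character hζ ((hpos ω hω).const_mul hMpos)
      ((hpos (-ω) (by simpa using hω)).const_mul hMpos)
      (fun g h => by simp only [hconj]) (fun g h => by simp only [hconj]) (hadd ω) g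
    rw [mul_assoc] at this
    exact mul_left_cancel₀ (inv_ne_zero (by simp [hM0])) this
  -- Polarisation: ω = 1 and ω = i together separate the sum over c k from the sum over the
  -- inverses.
  have e1 := hmul 1 (by simp)
  have e2 := hmul Complex.I (by simp)
  have hTe : ∀ ω g, T ω g = 2 * M * ζ g + ω * ∑ k, ζ (c k * g) +
      (starRingEnd ℂ) ω * ∑ k, ζ ((c k)⁻¹ * g) := by
    intro ω g
    simp only [T, Finset.sum_add_distrib, Finset.mul_sum]
    simp [hM]
    ring
  rw [hTe, hTe] at e1 e2
  simp only [map_one, Complex.conj_I, mul_one, hT.normalized] at e1 e2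
  linear_combination (1 / 2) * e1 - (Complex.I / 2) * e2 +
    (1 / 2) * (∑ k, ζ (c k * g) - ∑ k, ζ ((c k)⁻¹ * g) -
      (∑ k, ζ (c k) - ∑ k, ζ ((c k)⁻¹)) * ζ g) * Complex.I_mul_I

end Central

/-! ### Characters of finite groups -/

section FiniteGroup

variable {K : Type*} [Group K] [Fintype K]

theorem sum_conj_mul_of_inner {G : Type*} [Group G] {ζ : G → ℂ} (hζ : ζ ∈ Ch G) (ι : K →* G)
    (hι : ∀ g, ∃ k, ∀ x, g⁻¹ * ι x * g = ι (k⁻¹ * x * k)) (x : K) (g : G) :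
    ∑ k : K, ζ (ι (k⁻¹ * x * k) * g) = Fintype.card K * ζ (ι x) * ζ g := by
  rw [character_sum_mul hζ (fun k : K => ι (k⁻¹ * x * k))]
  · congr 1
    rw [Finset.sum_congr rfl (g := fun _ => ζ (ι x))]
    · simp
    · intro k _
      simpa using (Ch_subset_Tr hζ).conjInvariant (ι x) (ι k)
  · intro g
    obtain ⟨k₀, hk₀⟩ := hι g
    refine ⟨Equiv.mulRight k₀, fun k => ?_⟩
    rw [hk₀]
    simp [mul_assoc]

theorem sum_conj_mul_of_character {φ : K → ℂ} (hφ : φ ∈ Ch K) (x y : K) :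
    ∑ k : K, φ (k⁻¹ * x * k * y) = Fintype.card K * φ x * φ y :=
  sum_conj_mul_of_inner hφ (MonoidHom.id K) (fun g => ⟨g, fun _ => rfl⟩) x y

/-- The quadratic form of `φ` vanishes at the centered class sum of `x`. -/
theorem centered_sum_eq_zero {φ : K → ℂ} (hφ : IsTrace φ)
    (hmul : ∀ x y, ∑ k : K, φ (k⁻¹ * x * k * y) = Fintype.card K * φ x * φ y) (x : K) :
    ∑ i : Option K, ∑ j : Option K,
      i.elim (-(Fintype.card K * φ x)) (fun _ => 1) *
      (starRingEnd ℂ) (j.elim (-(Fintype.card K * φ x)) (fun _ => 1)) *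
      φ ((j.elim 1 fun k => k⁻¹ * x * k)⁻¹ * (i.elim 1 fun k => k⁻¹ * x * k)) = 0 := by
  have h1 : ∀ k, φ (k⁻¹ * x * k) = φ x := fun k => hφ.conjInvariant x k
  have h2 : ∀ k, φ ((k⁻¹ * x * k)⁻¹) = (starRingEnd ℂ) (φ x) := fun k => by
    rw [hφ.isPosDef.map_inv, h1]
  have h3 : ∑ k : K, ∑ l : K, φ ((l⁻¹ * x * l)⁻¹ * (k⁻¹ * x * k)) =
      Fintype.card K * (Fintype.card K * φ x * (starRingEnd ℂ) (φ x)) := by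
    rw [Finset.sum_comm, Finset.sum_congr rfl
      (g := fun _ => Fintype.card K * φ x * (starRingEnd ℂ) (φ x))]
    · simp
    · intro l _
      rw [← h2 l, ← hmul]
      exact Finset.sum_congr rfl fun k _ => hφ.map_mul_comm _ _
  simp only [Fintype.sum_option, Option.elim, inv_one, one_mul, mul_one, h1, h2, map_one, map_neg,
    map_mul, Finset.sum_add_distrib, h3, hφ.normalized, Finset.sum_const, Finset.card_univ,
    nsmul_eq_mul, map_natCast]
  ring

/-- A trace on a finite group that is multiplicative on class sums is a character. -/
theorem mem_Ch_of_sum_conj_mul {φ : K → ℂ} (hφ : φ ∈ Tr K)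
    (hmul : ∀ x y, ∑ k : K, φ (k⁻¹ * x * k * y) = Fintype.card K * φ x * φ y) : φ ∈ Ch K := by
  refine mem_extremePoints_iff_left.mpr ⟨hφ, fun a ha b hb hseg => funext fun x => ?_⟩
  obtain ⟨s, t, hs, ht, -, rfl⟩ := hseg
  set φ := s • a + t • b with hφdef
  have h0 := centered_sum_eq_zero hφ hmul x
  set β : Option K → ℂ := fun i => i.elim (-(Fintype.card K * φ x)) (fun _ => 1) with hβ
  set g : Option K → K := fun i => i.elim 1 fun k => k⁻¹ * x * k with hg
  have qa := ha.isPosDef.sum_nonneg g β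
  have qb := hb.isPosDef.sum_nonneg g β
  have hsplit : (∑ i, ∑ j, β i * (starRingEnd ℂ) (β j) * φ ((g j)⁻¹ * g i)) =
      s * (∑ i, ∑ j, β i * (starRingEnd ℂ) (β j) * a ((g j)⁻¹ * g i)) +
      t * (∑ i, ∑ j, β i * (starRingEnd ℂ) (β j) * b ((g j)⁻¹ * g i)) := by
    simp only [Finset.mul_sum, ← Finset.sum_add_distrib]
    refine Finset.sum_congr rfl fun i _ => Finset.sum_congr rfl fun j _ => ?_
    simp only [hφdef, Pi.add_apply, Pi.smul_apply, Complex.real_smul]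
    ring
  have hsum := hsplit.symm.trans h0
  have hs' : (0 : ℂ) < s := by exact_mod_cast hs
  have ht' : (0 : ℂ) < t := by exact_mod_cast ht
  -- Two nonnegative forms with positive weights add up to zero, so `a` is also degenerate at the
  -- centred class sum. Pairing that vector with 1 then gives |K|·a(x) = |K|·φ(x).
  have qa0 : ∑ i, ∑ j, β i * (starRingEnd ℂ) (β j) * a ((g j)⁻¹ * g i) = 0 := by
    have := ((add_eq_zero_iff_of_nonneg (mul_nonneg hs'.le qa) (mul_nonneg ht'.le qb)).mp hsum).1
    exact (mul_eq_zero.mp this).resolve_left hs'.ne'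
  have := ha.isPosDef.sum_eq_zero g β qa0 1
  simp only [hβ, hg, Fintype.sum_option, Option.elim, inv_one, one_mul, ha.conjInvariant x,
    ha.normalized, Finset.sum_const, Finset.card_univ, nsmul_eq_mul, mul_one] at this
  have hM : (Fintype.card K : ℂ) ≠ 0 := by simp
  refine mul_left_cancel₀ hM ?_
  linear_combination this

variable {G : Type*} [Group G] {ζ : G → ℂ}

/-- A character restricts to a character of a finite subgroup on which all inner automorphisms
restrict to inner automorphisms. -/
theorem character_comp_of_inner (hζ : ζ ∈ Ch G) (ι : K →* G)
    (hι : ∀ g, ∃ k, ∀ x, g⁻¹ * ι x * g = ι (k⁻¹ * x * k)) : (fun k => ζ (ι k)) ∈ Ch K := by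
  refine mem_Ch_of_sum_conj_mul ((Ch_subset_Tr hζ).comp ι) fun x y => ?_
  simpa only [map_mul] using sum_conj_mul_of_inner hζ ι hι x (ι y)

/-- A trace whose restriction to a finite subgroup is a character is multiplicative with respect
to elements that commute with this subgroup. -/
theorem IsTrace.map_mul_of_commute (hζ : IsTrace ζ) (ι : K →* G)
    (hι : (fun k => ζ (ι k)) ∈ Ch K) (x : K) {g : G} (hg : ∀ k, Commute (ι k) g) :
    ζ (ι x * g) = ζ (ι x) * ζ g := by
  have h0 := centered_sum_eq_zero (hζ.comp ι) (sum_conj_mul_of_character hι) x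
  -- Pairing the null vector with g⁻¹. All conjugates of x contribute the same value because g
  -- commutes with the image of `ι`.
  have h1 := hζ.isPosDef.sum_eq_zero (fun i : Option K => ι (i.elim 1 fun k => k⁻¹ * x * k))
    (fun i => i.elim (-(Fintype.card K * ζ (ι x))) (fun _ => 1)) (by simpa using h0) g⁻¹
  have h2 : ∀ k, ζ (g * ι (k⁻¹ * x * k)) = ζ (ι x * g) := by
    intro k
    rw [← hζ.conjInvariant (ι x * g) (ι k)]
    congr 1
    rw [← (hg (k⁻¹ * x * k)).eq, map_mul, map_mul, map_inv, mul_assoc _ (ι k), (hg k).eq]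
    simp only [mul_assoc]
  simp only [Fintype.sum_option, Option.elim, inv_inv, one_mul, map_one, mul_one, h2,
    Finset.sum_const, Finset.card_univ, nsmul_eq_mul] at h1
  have hM : (Fintype.card K : ℂ) ≠ 0 := by simp
  refine mul_left_cancel₀ hM ?_
  linear_combination h1

end FiniteGroup

/-! ### The structure of the diagonal product -/

theorem surjective_of_normal_range {K L : Type*} [Group K] [Group L] [IsSimpleGroup L]
    (f : K →* L) (hn : f.range.Normal) {x : K} (hx : f x ≠ 1) : Function.Surjective f := by
  rcases hn.eq_bot_or_eq_top with h | h
  · exact absurd (Subgroup.mem_bot.mp (h ▸ ⟨x, rfl⟩ : f x ∈ (⊥ : Subgroup L))) hx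
  · exact MonoidHom.range_eq_top.mp h

theorem nonempty_mulEquiv_of_surjective {K L : Type*} [Group K] [Group L] [IsSimpleGroup K]
    [Nontrivial L] (f : K →* L) (hf : Function.Surjective f) : Nonempty (K ≃* L) := by
  rcases (MonoidHom.normal_ker f).eq_bot_or_eq_top with h | h
  · exact ⟨MulEquiv.ofBijective f ⟨(MonoidHom.ker_eq_bot_iff f).mp h, hf⟩⟩
  · obtain ⟨y, hy⟩ := exists_ne (1 : L)
    obtain ⟨x, rfl⟩ := hf y
    exact absurd (MonoidHom.mem_ker.mp (h ▸ Subgroup.mem_top x)) hy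

section Structure

variable {G : Type*} [Group G] {H : ℕ → Type*} [∀ n, Group (H n)] {S : Set G}
  {θ : ∀ n, G → H n}

theorem tailMap_surjective (hθ : IsLEFApprox θ) (hSgen : Subgroup.closure S = ⊤) :
    Function.Surjective (hθ.tailMap S) := by
  rw [← MonoidHom.range_eq_top, eq_top_iff, ← hSgen, Subgroup.closure_le]
  exact fun s hs => ⟨_, hθ.tailMap_generator S hs⟩

theorem tailMap_eq_iff (hθ : IsLEFApprox θ) (γ δ : diagonalProduct S θ) :
    hθ.tailMap S γ = hθ.tailMap S δ ↔
      ∀ᶠ n in atTop, (γ : ∀ n, H n) n = (δ : ∀ n, H n) n := by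
  constructor
  · intro h
    filter_upwards [hθ.tailMap_spec S γ, hθ.tailMap_spec S δ] with n h1 h2
    rw [h1, h2, h]
  · intro h
    refine hθ.eq_of_eventually_eq ?_
    filter_upwards [hθ.tailMap_spec S γ, hθ.tailMap_spec S δ, h] with n h1 h2 h3
    rw [← h1, ← h2, h3]

theorem tailMap_ker (hθ : IsLEFApprox θ) : (hθ.tailMap S).ker = sumSubgroup S θ := by
  ext γ
  rw [MonoidHom.mem_ker, ← map_one (hθ.tailMap S), tailMap_eq_iff, ← Nat.cofinite_eq_atTop]
  exact Iff.rfl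

theorem surjective_eval (hess : IsEssentialBySimple S θ) (n : ℕ) (x : H n) :
    ∃ γ ∈ diagonalProduct S θ, γ n = x := by
  have : (diagonalProduct S θ).map (Pi.evalMonoidHom H n) = ⊤ := by
    rw [diagonalProduct, MonoidHom.map_closure, ← hess.generates n, Set.image_image]
    rfl
  obtain ⟨γ, h1, h2⟩ := Subgroup.mem_map.mp (this ▸ Subgroup.mem_top x)
  exact ⟨γ, h1, h2⟩

/-- Otherwise evaluation at `n` kills the kernel of the tail map and descends to a homomorphism on
`G` extending `θ n` on `S`. -/
theorem exists_mem_directSum_ne_one (hθ : IsLEFApprox θ) (hSgen : Subgroup.closure S = ⊤)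
    (hess : IsEssentialBySimple S θ) (n : ℕ) :
    ∃ γ ∈ diagonalProduct S θ, γ ∈ directSum H ∧ γ n ≠ 1 := by
  by_contra! hcon
  let ev : diagonalProduct S θ →* H n := (Pi.evalMonoidHom H n).comp (Subgroup.subtype _)
  have hker : (hθ.tailMap S).ker ≤ ev.ker := fun γ hγ => by
    rw [tailMap_ker] at hγ
    exact hcon γ γ.2 hγ
  have hsurj := tailMap_surjective hθ hSgen
  refine hess.not_extend n ⟨(hθ.tailMap S).liftOfSurjective hsurj ⟨ev, hker⟩, fun s hs => ?_⟩
  conv_lhs => rw [← hθ.tailMap_generator S hs]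
  exact MonoidHom.liftOfRightInverse_comp_apply _ _ _ ⟨ev, hker⟩ _

/-- The elements of the diagonal product supported in `F`. -/
def supportedIn (S : Set G) (θ : ∀ n, G → H n) (F : Set ℕ) : Subgroup (∀ n, H n) where
  carrier := {γ | γ ∈ diagonalProduct S θ ∧ ∀ i ∉ F, γ i = 1}
  one_mem' := ⟨one_mem _, fun _ _ => rfl⟩
  mul_mem' ha hb := ⟨mul_mem ha.1 hb.1, fun i hi => by simp [ha.2 i hi, hb.2 i hi]⟩
  inv_mem' ha := ⟨inv_mem ha.1, fun i hi => by simp [ha.2 i hi]⟩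

/-- Conjugation by Γ preserves supports and Γ maps onto `H n`, so the image is a normal subgroup;
`w` makes it nontrivial. -/
theorem supportedIn_eval_surjective (hess : IsEssentialBySimple S θ) {F : Set ℕ} {n : ℕ}
    {w : ∀ n, H n} (hw : w ∈ supportedIn S θ F) (hn : w n ≠ 1) :
    Function.Surjective ((Pi.evalMonoidHom H n).comp (supportedIn S θ F).subtype) := by
  have := hess.simple n
  refine surjective_of_normal_range _ ⟨?_⟩ (x := ⟨w, hw⟩) hn
  rintro _ ⟨x, rfl⟩ h
  obtain ⟨δ, hδ, rfl⟩ := surjective_eval hess n h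
  refine ⟨⟨δ * x * δ⁻¹, mul_mem (mul_mem hδ x.2.1) (inv_mem hδ), fun i hi => ?_⟩, rfl⟩
  simp [x.2.2 i hi]

theorem exists_mulSingle_mem (hθ : IsLEFApprox θ) (hSgen : Subgroup.closure S = ⊤)
    (hess : IsEssentialBySimple S θ) (n : ℕ) :
    ∃ x : H n, x ≠ 1 ∧ Pi.mulSingle n x ∈ diagonalProduct S θ := by
  have hex : ∃ c, ∃ γ ∈ diagonalProduct S θ, γ ∈ directSum H ∧ γ n ≠ 1 ∧
      {i | γ i ≠ 1}.ncard = c := by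
    obtain ⟨γ, h1, h2, h3⟩ := exists_mem_directSum_ne_one hθ hSgen hess n
    exact ⟨_, γ, h1, h2, h3, rfl⟩
  classical
  obtain ⟨w, hwΓ, hwU, hwn, hc⟩ := Nat.find_spec hex
  set F := {i | w i ≠ 1} with hF
  have hFfin : F.Finite := hwU
  have hwF : w ∈ supportedIn S θ F := ⟨hwΓ, fun i hi => by simpa [hF] using hi⟩
  suffices h : ∀ m, m ≠ n → w m = 1 by
    refine ⟨w n, hwn, ?_⟩
    convert hwΓ
    funext m
    rcases eq_or_ne m n with rfl | hm
    · simp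
    · simp [hm, h m hm]
  intro m hmn
  by_contra hwm
  have sm := supportedIn_eval_surjective hess hwF hwm
  have sn := supportedIn_eval_surjective hess hwF hwn
  -- An element trivial at m has support strictly inside F, so minimality makes it trivial at n.
  -- Evaluation at n thus factors through evaluation at m, giving an epimorphism H m → H n of simple
  -- groups.
  have hker : ((Pi.evalMonoidHom H m).comp (supportedIn S θ F).subtype).ker ≤
      ((Pi.evalMonoidHom H n).comp (supportedIn S θ F).subtype).ker := by
    rintro ⟨x, hxΓ, hxF⟩ (hx : x m = 1)
    change x n = 1
    by_contra hxn
    have hsub : {i | x i ≠ 1} ⊆ F := fun i hi => by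
      by_contra h
      exact hi (hxF i h)
    refine Nat.find_min hex (m := {i | x i ≠ 1}.ncard) ?_
      ⟨x, hxΓ, hFfin.subset hsub, hxn, rfl⟩
    rw [← hc]
    exact Set.ncard_lt_ncard ((Set.ssubset_iff_of_subset hsub).mpr ⟨m, hwm, by simp [hx]⟩) hFfin
  have := hess.simple m
  have := hess.simple n
  let f := MonoidHom.liftOfSurjective _ sm ⟨_, hker⟩
  have hf : Function.Surjective f := by
    intro y
    obtain ⟨x, rfl⟩ := sn y
    exact ⟨_, MonoidHom.liftOfRightInverse_comp_apply _ _ _ ⟨_, hker⟩ x⟩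
  obtain ⟨e⟩ := nonempty_mulEquiv_of_surjective f hf
  exact (hess.pairwise_not_iso m n hmn).false e

theorem mulSingle_mem (hθ : IsLEFApprox θ) (hSgen : Subgroup.closure S = ⊤)
    (hess : IsEssentialBySimple S θ) (n : ℕ) (x : H n) :
    Pi.mulSingle n x ∈ diagonalProduct S θ := by
  have := hess.simple n
  let N : Subgroup (H n) := (diagonalProduct S θ).comap (MonoidHom.mulSingle H n)
  have hN : N.Normal := by
    refine ⟨fun x hx h => ?_⟩
    obtain ⟨δ, hδ, rfl⟩ := surjective_eval hess n h
    change Pi.mulSingle n _ ∈ diagonalProduct S θ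
    have hx' : Pi.mulSingle n x ∈ diagonalProduct S θ := hx
    convert mul_mem (mul_mem hδ hx') (inv_mem hδ)
    funext m
    rcases eq_or_ne m n with rfl | hm
    · simp
    · simp [hm]
  obtain ⟨y, hy, hyN⟩ := exists_mulSingle_mem hθ hSgen hess n
  have hNtop : N = ⊤ := hN.eq_bot_or_eq_top.resolve_left fun h =>
    hy (Subgroup.mem_bot.mp (h ▸ (hyN : y ∈ N)))
  exact (hNtop ▸ Subgroup.mem_top x : x ∈ N)

theorem directSum_le (hθ : IsLEFApprox θ) (hSgen : Subgroup.closure S = ⊤)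
    (hess : IsEssentialBySimple S θ) : directSum H ≤ diagonalProduct S θ := by
  have key : ∀ (s : Finset ℕ) (f : ∀ n, H n), (∀ n ∉ s, f n = 1) → f ∈ diagonalProduct S θ := by
    intro s
    induction s using Finset.induction_on with
    | empty =>
      intro f hf
      convert one_mem (diagonalProduct S θ)
      funext n
      simpa using hf n
    | insert a s ha ih =>
      intro f hf
      have h : Function.update f a 1 ∈ diagonalProduct S θ := ih _ fun n hn => by
        rcases eq_or_ne n a with rfl | hna
        · simp
        · simpa [hna] using hf n (by simp [hn, hna])
      convert mul_mem (mulSingle_mem hθ hSgen hess a (f a)) h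
      funext n
      rcases eq_or_ne n a with rfl | hna
      · simp
      · simp [hna]
  intro f hf
  refine key (Set.Finite.toFinset hf) f fun n hn => ?_
  by_contra h
  exact hn ((Set.Finite.mem_toFinset hf).mpr h)

end Structure

/-! ### Groups between the direct sum and the direct product -/

/-- A group `W` between the direct sum and the direct product of the groups `H n`: it embeds into
the product, and contains all the factors. -/
structure FactorEmbedding (W : Type*) [Group W] (H : ℕ → Type*) [∀ n, Group (H n)] where
  /-- The embedding into the direct product. -/
  coord : W →* ∀ n, H n
  /-- The inclusions of the factors. -/
  incl : ∀ n, H n →* W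
  coord_injective : Function.Injective coord
  coord_incl : ∀ n x, coord (incl n x) = Pi.mulSingle n x

namespace FactorEmbedding

variable {W : Type*} [Group W] {H : ℕ → Type*} [∀ n, Group (H n)] (E : FactorEmbedding W H)

theorem commute_incl {n : ℕ} {γ : W} (hγ : E.coord γ n = 1) (x : H n) :
    Commute (E.incl n x) γ := by
  refine E.coord_injective ?_
  rw [map_mul, map_mul, E.coord_incl]
  funext m
  rcases eq_or_ne m n with rfl | hm
  · simp [hγ]
  · simp [hm]

theorem inv_mul_incl_mul (γ : W) (n : ℕ) (x : H n) :
    γ⁻¹ * E.incl n x * γ = E.incl n ((E.coord γ n)⁻¹ * x * E.coord γ n) := by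
  refine E.coord_injective ?_
  rw [map_mul, map_mul, E.coord_incl, E.coord_incl]
  funext m
  rcases eq_or_ne m n with rfl | hm
  · simp
  · simp [hm]

/-- Replace the first `n` coordinates of an element by `1`. -/
def erase : ℕ → W → W
  | 0, γ => γ
  | n + 1, γ => (E.incl n (E.coord γ n))⁻¹ * erase n γ

theorem coord_erase (n : ℕ) (γ : W) (m : ℕ) :
    E.coord (E.erase n γ) m = if m < n then 1 else E.coord γ m := by
  induction n with
  | zero => simp [erase]
  | succ n ih =>
    rw [erase, map_mul, map_inv, E.coord_incl, Pi.mul_apply, Pi.inv_apply, ih]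
    rcases lt_trichotomy m n with h | rfl | h
    · simp [h, h.ne, h.trans (Nat.lt_succ_self n)]
    · simp
    · simp [h.ne', h.not_gt, (Nat.succ_le_of_lt h).not_gt]

theorem erase_eq_iff (n : ℕ) (γ δ : W) :
    E.erase n γ = E.erase n δ ↔ ∀ m, n ≤ m → E.coord γ m = E.coord δ m := by
  rw [← E.coord_injective.eq_iff, funext_iff]
  simp only [coord_erase]
  refine forall_congr' fun m => ?_
  by_cases h : m < n
  · simp [h]
  · simp [h, not_lt.mp h]

/-- Being an endomorphism lets positivity and conjugation invariance pass to limits along erasures.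
-/
theorem erase_mul (n : ℕ) (γ δ : W) : E.erase n (γ * δ) = E.erase n γ * E.erase n δ := by
  refine E.coord_injective (funext fun m => ?_)
  rw [map_mul, Pi.mul_apply]
  simp only [coord_erase, map_mul, Pi.mul_apply]
  split_ifs <;> simp

theorem erase_one (n : ℕ) : E.erase n 1 = 1 := by
  refine E.coord_injective (funext fun m => ?_)
  simp [coord_erase]

theorem erase_inv (n : ℕ) (γ : W) : E.erase n γ⁻¹ = (E.erase n γ)⁻¹ := by
  refine E.coord_injective (funext fun m => ?_)
  rw [map_inv, Pi.inv_apply]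
  simp only [coord_erase, map_inv, Pi.inv_apply]
  split_ifs <;> simp

theorem erase_erase {m n : ℕ} (h : m ≤ n) (γ : W) : E.erase n (E.erase m γ) = E.erase n γ := by
  rw [erase_eq_iff]
  intro k hk
  simp [coord_erase, (h.trans hk).not_gt]

/-- The function `γ ↦ ∏ i < n, φ i (γ i)`. -/
def partialProd (φ : ∀ n, H n → ℂ) (n : ℕ) : W → ℂ :=
  fun γ => ∏ i ∈ Finset.range n, φ i (E.coord γ i)

variable {φ : ∀ n, H n → ℂ}

theorem isTrace_partialProd (hφ : ∀ n, IsTrace (φ n)) (n : ℕ) : IsTrace (E.partialProd φ n) :=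
  IsTrace.prod _ fun i _ => (hφ i).comp ((Pi.evalMonoidHom H i).comp E.coord)

theorem partialProd_incl (hφ : ∀ n, φ n 1 = 1) {N n : ℕ} (h : n < N) (x : H n) :
    E.partialProd φ N (E.incl n x) = φ n x := by
  rw [partialProd, Finset.prod_eq_single n]
  · rw [E.coord_incl, Pi.mulSingle_eq_same]
  · intro m _ hm
    rw [E.coord_incl, Pi.mulSingle_eq_of_ne hm, hφ]
  · simp [h]

variable [∀ n, Finite (H n)]

/-- A trace that restricts to characters on the factors splits off finitely many coordinates. -/
theorem eq_partialProd_mul (hφ : ∀ n, φ n ∈ Ch (H n)) {ζ : W → ℂ} (hζ : IsTrace ζ)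
    (hζφ : ∀ n x, ζ (E.incl n x) = φ n x) (n : ℕ) (γ : W) :
    ζ γ = E.partialProd φ n γ * ζ (E.erase n γ) := by
  induction n with
  | zero => simp [partialProd, erase]
  | succ n ih =>
    have := Fintype.ofFinite (H n)
    have hch : (fun x => ζ (E.incl n x)) ∈ Ch (H n) := by
      convert hφ n using 1
      exact funext (hζφ n)
    -- The erased element is trivial at n, hence commutes with the n-th factor.
    have hsplit := hζ.map_mul_of_commute (E.incl n) hch (E.coord γ n)
      (g := E.erase (n + 1) γ) fun k => E.commute_incl (by simp [coord_erase]) k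
    have he : E.erase n γ = E.incl n (E.coord γ n) * E.erase (n + 1) γ := by
      rw [erase, mul_inv_cancel_left]
    rw [ih, he, hsplit, hζφ, partialProd, partialProd, Finset.prod_range_succ, mul_assoc]

theorem incl_mem_Ch {ζ : W → ℂ} (hζ : ζ ∈ Ch W) (n : ℕ) : (fun x => ζ (E.incl n x)) ∈ Ch (H n) := by
  have := Fintype.ofFinite (H n)
  exact character_comp_of_inner hζ (E.incl n) fun g => ⟨_, fun x => E.inv_mul_incl_mul g n x⟩

end FactorEmbedding

/-! ### Characters of the direct sum -/

section Sum

variable {G : Type*} {H : ℕ → Type*} [∀ n, Group (H n)] {S : Set G}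
  {θ : ∀ n, G → H n} {φ : ∀ n, H n → ℂ}

theorem mulSingle_mem_directSum (n : ℕ) (x : H n) : Pi.mulSingle n x ∈ directSum H := by
  refine (Set.finite_singleton n).subset fun m hm => ?_
  by_contra h
  exact hm (Pi.mulSingle_eq_of_ne h x)

/-- The diagonal product lies between the direct sum and the direct product. -/
def diagonalEmbedding (hU : directSum H ≤ diagonalProduct S θ) :
    FactorEmbedding (diagonalProduct S θ) H where
  coord := (diagonalProduct S θ).subtype
  incl n := (MonoidHom.mulSingle H n).codRestrict _ fun x =>
    hU (mulSingle_mem_directSum n x)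
  coord_injective := Subtype.coe_injective
  coord_incl _ _ := rfl

/-- The direct sum, as a subgroup of the diagonal product. -/
def sumEmbedding (hU : directSum H ≤ diagonalProduct S θ) :
    FactorEmbedding (sumSubgroup S θ) H where
  coord := (diagonalProduct S θ).subtype.comp (sumSubgroup S θ).subtype
  incl n := ((diagonalEmbedding hU).incl n).codRestrict _ fun x => mulSingle_mem_directSum n x
  coord_injective := Subtype.coe_injective.comp Subtype.coe_injective
  coord_incl _ _ := rfl

variable (hU : directSum H ≤ diagonalProduct S θ)

theorem exists_coord_eq_one (u : sumSubgroup S θ) :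
    ∃ N, ∀ i, N ≤ i → (sumEmbedding hU).coord u i = 1 := by
  have h : ∀ᶠ i in cofinite, (sumEmbedding hU).coord u i = 1 := u.2
  rw [Nat.cofinite_eq_atTop] at h
  exact eventually_atTop.mp h

theorem tensor_eq_partialProd (hφ : ∀ n, φ n 1 = 1) {u : sumSubgroup S θ} {N : ℕ}
    (hN : ∀ i, N ≤ i → (sumEmbedding hU).coord u i = 1) :
    tensor S θ φ u = (sumEmbedding hU).partialProd φ N u := by
  refine finprod_eq_prod_of_mulSupport_subset _ fun i hi => ?_
  by_contra h
  refine hi ?_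
  have := hN i (by simpa using h)
  change φ i ((sumEmbedding hU).coord u i) = 1
  rw [this, hφ]

theorem tensor_incl (hφ : ∀ n, φ n 1 = 1) (n : ℕ) (x : H n) :
    tensor S θ φ ((sumEmbedding hU).incl n x) = φ n x := by
  rw [tensor_eq_partialProd hU hφ (N := n + 1), FactorEmbedding.partialProd_incl _ hφ (by simp)]
  intro i hi
  rw [FactorEmbedding.coord_incl, Pi.mulSingle_eq_of_ne (by lia)]

theorem tensor_mem_Tr (hU : directSum H ≤ diagonalProduct S θ) (hφ : ∀ n, IsTrace (φ n)) :
    tensor S θ φ ∈ Tr (sumSubgroup S θ) := by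
  refine isClosed_Tr.mem_of_tendsto (f := fun N => (sumEmbedding hU).partialProd φ N)
    (b := atTop) (tendsto_pi_nhds.mpr fun u => ?_)
    (Eventually.of_forall fun N => (sumEmbedding hU).isTrace_partialProd hφ N)
  obtain ⟨N, hN⟩ := exists_coord_eq_one hU u
  refine tendsto_const_nhds.congr' (EventuallyEq.symm ?_)
  filter_upwards [eventually_ge_atTop N] with n hn
  exact (tensor_eq_partialProd hU (fun n => (hφ n).normalized) fun i hi => hN i (hn.trans hi)).symm

variable [∀ n, Finite (H n)]

/-- A trace on the direct sum that restricts to characters on the factors is their tensor product. -/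
theorem eq_tensor (hφ : ∀ n, φ n ∈ Ch (H n)) {ζ : sumSubgroup S θ → ℂ} (hζ : IsTrace ζ)
    (hζφ : ∀ n x, ζ ((sumEmbedding hU).incl n x) = φ n x) : ζ = tensor S θ φ := by
  funext u
  obtain ⟨N, hN⟩ := exists_coord_eq_one hU u
  rw [(sumEmbedding hU).eq_partialProd_mul hφ hζ hζφ N u,
    tensor_eq_partialProd hU (fun n => (Ch_subset_Tr (hφ n)).normalized) hN]
  have : (sumEmbedding hU).erase N u = 1 := by
    rw [← (sumEmbedding hU).erase_one N, FactorEmbedding.erase_eq_iff]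
    intro m hm
    rw [hN m hm, map_one, Pi.one_apply]
  rw [this, hζ.normalized, mul_one]

theorem restrict_eq_of_mem_openSegment {W : Type*} [Group W] {K : Type*} [Group K] (ι : K →* W)
    {ζ a b : W → ℂ} (hζ : (fun k => ζ (ι k)) ∈ Ch K) (ha : IsTrace a) (hb : IsTrace b)
    (h : ζ ∈ openSegment ℝ a b) : (fun k => a (ι k)) = fun k => ζ (ι k) := by
  obtain ⟨s, t, hs, ht, hst, rfl⟩ := h
  exact hζ.2 (ha.comp ι) (hb.comp ι) ⟨s, t, hs, ht, hst, rfl⟩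

theorem tensor_mem_Ch (hU : directSum H ≤ diagonalProduct S θ) (hφ : ∀ n, φ n ∈ Ch (H n)) :
    tensor S θ φ ∈ Ch (sumSubgroup S θ) := by
  have h1 : ∀ n, φ n 1 = 1 := fun n => (Ch_subset_Tr (hφ n)).normalized
  refine mem_extremePoints_iff_left.mpr
    ⟨tensor_mem_Tr hU fun n => Ch_subset_Tr (hφ n), fun a ha b hb hseg => ?_⟩
  -- Extremality is only needed on each factor: there `a` must agree with φ n, and this determines
  -- `a`.
  refine eq_tensor hU hφ ha fun n x => ?_
  have hn : (fun x => tensor S θ φ ((sumEmbedding hU).incl n x)) = φ n :=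
    funext (tensor_incl hU h1 n)
  have := restrict_eq_of_mem_openSegment ((sumEmbedding hU).incl n) (hn ▸ hφ n) ha hb hseg
  rw [congrFun this x, tensor_incl hU h1]

theorem tensor_bijOn (hU : directSum H ≤ diagonalProduct S θ) :
    Set.BijOn (tensor S θ) {φ | ∀ n, φ n ∈ Ch (H n)} (Ch (sumSubgroup S θ)) := by
  refine ⟨fun φ hφ => tensor_mem_Ch hU hφ, fun φ hφ φ' hφ' h => ?_, fun ζ hζ => ?_⟩
  · funext n x
    rw [← tensor_incl hU (fun n => (Ch_subset_Tr (hφ n)).normalized) n x, h,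
      tensor_incl hU (fun n => (Ch_subset_Tr (hφ' n)).normalized) n x]
  · have hφ : ∀ n, (fun x => ζ ((sumEmbedding hU).incl n x)) ∈ Ch (H n) :=
      (sumEmbedding hU).incl_mem_Ch hζ
    exact ⟨_, hφ, (eq_tensor hU hφ (Ch_subset_Tr hζ) fun _ _ => rfl).symm⟩

theorem mem_tracesOver_iff (hφ : ∀ n, φ n ∈ Ch (H n)) {ζ : diagonalProduct S θ → ℂ} :
    ζ ∈ tracesOver S θ φ ↔
      IsTrace ζ ∧ ∀ n x, ζ ((diagonalEmbedding hU).incl n x) = φ n x := by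
  refine and_congr_right fun hζ => ⟨fun h n x => ?_, fun h => ?_⟩
  · rw [← tensor_incl hU (fun n => (Ch_subset_Tr (hφ n)).normalized) n x, ← h]
    rfl
  · exact eq_tensor hU hφ (hζ.comp (sumSubgroup S θ).subtype) h

/-- The traces over a character of the direct sum form a face of the set of all traces. -/
theorem isExtreme_tracesOver (hU : directSum H ≤ diagonalProduct S θ)
    (hφ : ∀ n, φ n ∈ Ch (H n)) : IsExtreme ℝ (Tr (diagonalProduct S θ)) (tracesOver S θ φ) := by
  refine ⟨fun ζ hζ => hζ.1, fun a ha b hb ζ hζ hseg => ⟨ha, ?_⟩⟩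
  rw [← hζ.2]
  refine restrict_eq_of_mem_openSegment (sumSubgroup S θ).subtype (ζ := ζ) ?_ ha hb hseg
  have := tensor_mem_Ch hU hφ
  rwa [← hζ.2] at this

end Sum

/-! ### Homeomorphisms, extreme points and accumulation points -/

section General

theorem mem_of_mapClusterPt {X : Type*} [TopologicalSpace X] {C : Set X} (hC : IsClosed C)
    {u : ℕ → X} {x : X} (hx : MapClusterPt x atTop u) (hu : ∀ᶠ n in atTop, u n ∈ C) : x ∈ C := by
  by_contra h
  obtain ⟨n, hn, hn'⟩ := ((hx.frequently (hC.isOpen_compl.mem_nhds h)).and_eventually hu).exists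
  exact hn hn'

theorem eq_of_mapClusterPt_of_tendsto {X : Type*} [TopologicalSpace X] [T2Space X]
    {u : ℕ → X} {x y : X} (hx : MapClusterPt x atTop u) (hy : Tendsto u atTop (𝓝 y)) : x = y := by
  have : (𝓝 x ⊓ 𝓝 y).NeBot := ClusterPt.mono hx hy
  exact eq_of_nhds_neBot this

theorem image_extremePoints_of_injOn {X Y : Type*} [AddCommGroup X] [Module ℂ X] [Module ℝ X]
    [IsScalarTower ℝ ℂ X] [AddCommGroup Y] [Module ℂ Y] [Module ℝ Y] [IsScalarTower ℝ ℂ Y]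
    {f : X →ₗ[ℂ] Y} {A : Set X} (hA : Convex ℝ A) (hinj : Set.InjOn f A) :
    f '' A.extremePoints ℝ = (f '' A).extremePoints ℝ := by
  have hlin : ∀ (s t : ℝ) (a b : X), f (s • a + t • b) = s • f a + t • f b := fun s t a b => by
    rw [map_add, ← algebraMap_smul ℂ s a, ← algebraMap_smul ℂ t b, map_smul, map_smul,
      algebraMap_smul, algebraMap_smul]
  ext y
  constructor
  · rintro ⟨x, hx, rfl⟩
    refine ⟨⟨x, hx.1, rfl⟩, ?_⟩
    rintro _ ⟨a, ha, rfl⟩ _ ⟨b, hb, rfl⟩ ⟨s, t, hs, ht, hst, h⟩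
    rw [← hlin] at h
    have := hinj (hA ha hb hs.le ht.le hst) hx.1 h
    rw [hx.2 ha hb ⟨s, t, hs, ht, hst, this⟩]
  · rintro ⟨⟨x, hx, rfl⟩, h⟩
    refine ⟨x, ⟨hx, ?_⟩, rfl⟩
    rintro a ha b hb ⟨s, t, hs, ht, hst, rfl⟩
    exact hinj ha hx (h ⟨a, ha, rfl⟩ ⟨b, hb, rfl⟩ ⟨s, t, hs, ht, hst, (hlin s t a b).symm⟩)

variable {X Y : Type*} [AddCommGroup X] [Module ℂ X] [TopologicalSpace X]
  [AddCommGroup Y] [Module ℂ Y] [TopologicalSpace Y] {f : X →ₗ[ℂ] Y} {A A' : Set X}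

theorem restrictsToHomeomorph_image (hf : IsEmbedding fun x : A => f x) :
    RestrictsToHomeomorph f A (f '' A) :=
  ⟨hf.toHomeomorph.trans (Homeomorph.setCongr (by rw [Set.image_eq_range])), fun _ => rfl⟩

theorem isEmbedding_of_isCompact [T2Space Y] (hf : Continuous f) (hinj : Set.InjOn f A)
    (hA : IsCompact A) : IsEmbedding fun x : A => f x := by
  have := isCompact_iff_compactSpace.mp hA
  exact ((hf.comp continuous_subtype_val).isClosedEmbedding
    (Set.injOn_iff_injective.mp hinj)).isEmbedding

theorem isEmbedding_of_subset (hf : IsEmbedding fun x : A => f x) (h : A' ⊆ A) :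
    IsEmbedding fun x : A' => f x :=
  hf.comp (IsEmbedding.inclusion h)

end General

theorem convex_Tr {G : Type*} [Group G] : Convex ℝ (Tr G) := by
  intro a ha b hb s t hs ht hst
  refine ⟨fun n g α => ?_, ?_, fun g h => ?_⟩
  · have hs' : (0 : ℂ) ≤ s := by exact_mod_cast hs
    have ht' : (0 : ℂ) ≤ t := by exact_mod_cast ht
    convert add_nonneg (mul_nonneg hs' (ha.posDef n g α)) (mul_nonneg ht' (hb.posDef n g α))
      using 1
    simp only [Finset.mul_sum, ← Finset.sum_add_distrib, Pi.add_apply, Pi.smul_apply,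
      Complex.real_smul]
    refine Finset.sum_congr rfl fun i _ => Finset.sum_congr rfl fun j _ => by ring
  · simp only [Pi.add_apply, Pi.smul_apply, ha.normalized, hb.normalized, Complex.real_smul,
      mul_one]
    exact_mod_cast hst
  · simp only [Pi.add_apply, Pi.smul_apply, ha.conjInvariant, hb.conjInvariant]

/-! ### Auxiliary traces -/

section Auxiliary

variable {G : Type*} {H : ℕ → Type*} [∀ n, Group (H n)] {S : Set G}
  {θ : ∀ n, G → H n} {φ : ∀ n, H n → ℂ}

theorem isTrace_partialTensor (hφ : ∀ n, IsTrace (φ n)) (n : ℕ) :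
    IsTrace (partialTensor S θ φ n) :=
  IsTrace.prod _ fun i _ => (hφ i).comp
    ((Pi.evalMonoidHom H i).comp (diagonalProduct S θ).subtype)

theorem exists_isAuxiliary (hφ : ∀ n, IsTrace (φ n)) : ∃ φhat, IsAuxiliary S θ φ φhat := by
  obtain ⟨φhat, -, h⟩ := isCompact_Tr (G := diagonalProduct S θ)
    (f := map (partialTensor S θ φ) atTop)
    (le_principal_iff.mpr (mem_map.mpr (Eventually.of_forall fun n =>
      isTrace_partialTensor hφ n)))
  exact ⟨φhat, h⟩

theorem IsAuxiliary.mem_Tr {φhat : diagonalProduct S θ → ℂ} (hhat : IsAuxiliary S θ φ φhat)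
    (hφ : ∀ n, IsTrace (φ n)) : φhat ∈ Tr (diagonalProduct S θ) :=
  mem_of_mapClusterPt isClosed_Tr hhat (Eventually.of_forall fun n => isTrace_partialTensor hφ n)

theorem IsAuxiliary.apply_incl {φhat : diagonalProduct S θ → ℂ} (hhat : IsAuxiliary S θ φ φhat)
    (hφ : ∀ n, IsTrace (φ n)) (hU : directSum H ≤ diagonalProduct S θ) (n : ℕ) (x : H n) :
    φhat ((diagonalEmbedding hU).incl n x) = φ n x := by
  have hC : IsClosed {f : diagonalProduct S θ → ℂ |
      f ((diagonalEmbedding hU).incl n x) = φ n x} :=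
    isClosed_eq (continuous_apply _) continuous_const
  refine mem_of_mapClusterPt hC hhat ?_
  filter_upwards [eventually_gt_atTop n] with N hN
  exact (diagonalEmbedding hU).partialProd_incl (fun n => (hφ n).normalized) hN x

/-- The partial products may oscillate in phase, but their moduli decrease and so converge; the
limit agrees with the modulus of any accumulation point. -/
theorem IsAuxiliary.tendsto_norm {φhat : diagonalProduct S θ → ℂ} (hhat : IsAuxiliary S θ φ φhat)
    (hφ : ∀ n, IsTrace (φ n)) (γ : diagonalProduct S θ) :
    Tendsto (fun n => ‖partialTensor S θ φ n γ‖) atTop (𝓝 ‖φhat γ‖) := by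
  have hanti : Antitone fun n => ‖partialTensor S θ φ n γ‖ := by
    refine antitone_nat_of_succ_le fun n => ?_
    rw [partialTensor, partialTensor, Finset.prod_range_succ, norm_mul]
    exact mul_le_of_le_one_right (norm_nonneg _) ((hφ n).norm_le_one _)
  have hlim := tendsto_atTop_ciInf hanti ⟨0, by rintro _ ⟨n, rfl⟩; exact norm_nonneg _⟩
  have hcl : MapClusterPt ‖φhat γ‖ atTop fun n => ‖partialTensor S θ φ n γ‖ :=
    MapClusterPt.continuousAt_comp (f := fun f : diagonalProduct S θ → ℂ => ‖f γ‖)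
      (continuous_apply γ).norm.continuousAt hhat
  rwa [eq_of_mapClusterPt_of_tendsto hcl hlim]

variable [∀ n, Finite (H n)] (hU : directSum H ≤ diagonalProduct S θ)
  {ζ φhat : diagonalProduct S θ → ℂ}

theorem eq_partialTensor_mul (hφ : ∀ n, φ n ∈ Ch (H n)) (hζ : ζ ∈ tracesOver S θ φ) (n : ℕ)
    (γ : diagonalProduct S θ) :
    ζ γ = partialTensor S θ φ n γ * ζ ((diagonalEmbedding hU).erase n γ) :=
  (diagonalEmbedding hU).eq_partialProd_mul hφ hζ.1 ((mem_tracesOver_iff hU hφ).mp hζ).2 n γ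

theorem IsAuxiliary.mem_tracesOver (hhat : IsAuxiliary S θ φ φhat) (hφ : ∀ n, φ n ∈ Ch (H n))
    (hU : directSum H ≤ diagonalProduct S θ) : φhat ∈ tracesOver S θ φ :=
  (mem_tracesOver_iff hU hφ).mpr ⟨hhat.mem_Tr fun n => Ch_subset_Tr (hφ n),
    hhat.apply_incl (fun n => Ch_subset_Tr (hφ n)) hU⟩

theorem IsAuxiliary.norm_le (hhat : IsAuxiliary S θ φ φhat) (hφ : ∀ n, φ n ∈ Ch (H n))
    (hU : directSum H ≤ diagonalProduct S θ) (hζ : ζ ∈ tracesOver S θ φ)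
    (γ : diagonalProduct S θ) : ‖ζ γ‖ ≤ ‖φhat γ‖ := by
  refine ge_of_tendsto (hhat.tendsto_norm (fun n => Ch_subset_Tr (hφ n)) γ)
    (Eventually.of_forall fun n => ?_)
  rw [eq_partialTensor_mul hU hφ hζ n, norm_mul]
  exact mul_le_of_le_one_right (norm_nonneg _) (hζ.1.norm_le_one _)

/-- If `φhat γ ≠ 0`, the quotient `ζ γ / φhat γ` is recovered from the tails of `γ`. -/
theorem IsAuxiliary.tendsto_div (hhat : IsAuxiliary S θ φ φhat) (hφ : ∀ n, φ n ∈ Ch (H n))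
    (hζ : ζ ∈ tracesOver S θ φ) {γ : diagonalProduct S θ} (hγ : φhat γ ≠ 0) :
    Tendsto (fun n => ζ ((diagonalEmbedding hU).erase n γ) *
      (starRingEnd ℂ) (φhat ((diagonalEmbedding hU).erase n γ))) atTop (𝓝 (ζ γ / φhat γ)) := by
  have hnorm : ‖φhat γ‖ ≠ 0 := norm_ne_zero_iff.mpr hγ
  have hmem := hhat.mem_tracesOver hφ hU
  have hP : ∀ n, partialTensor S θ φ n γ ≠ 0 := fun n h0 =>
    hγ (by rw [eq_partialTensor_mul hU hφ hmem n, h0, zero_mul])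
  have hlim : Tendsto (fun n => ‖φhat ((diagonalEmbedding hU).erase n γ)‖) atTop (𝓝 1) := by
    have := (tendsto_const_nhds (x := ‖φhat γ‖)).div
      (hhat.tendsto_norm (fun n => Ch_subset_Tr (hφ n)) γ) hnorm
    rw [div_self hnorm] at this
    refine this.congr fun n => ?_
    rw [Pi.div_apply, eq_partialTensor_mul hU hφ hmem n, norm_mul,
      mul_div_cancel_left₀ _ (norm_ne_zero_iff.mpr (hP n))]
  have hlim2 : Tendsto (fun n => ζ γ / φhat γ *
      ((‖φhat ((diagonalEmbedding hU).erase n γ)‖ : ℂ) ^ 2)) atTop (𝓝 (ζ γ / φhat γ)) := by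
    have h1 := ((Complex.continuous_ofReal.tendsto 1).comp hlim).pow 2
    simpa using h1.const_mul (ζ γ / φhat γ)
  refine hlim2.congr fun n => ?_
  have hz := eq_partialTensor_mul hU hφ hζ n γ
  have hh := eq_partialTensor_mul hU hφ hmem n γ
  have hE : φhat ((diagonalEmbedding hU).erase n γ) ≠ 0 := fun h0 => hγ (by rw [hh, h0, mul_zero])
  rw [hz, hh, ← Complex.mul_conj', mul_div_mul_left _ _ (hP n)]
  field_simp

theorem IsAuxiliary.exists_tendsto (hhat : IsAuxiliary S θ φ φhat) (hφ : ∀ n, φ n ∈ Ch (H n))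
    (hζ : ζ ∈ tracesOver S θ φ) (γ : diagonalProduct S θ) :
    ∃ L, Tendsto (fun n => ζ ((diagonalEmbedding hU).erase n γ) *
      (starRingEnd ℂ) (φhat ((diagonalEmbedding hU).erase n γ))) atTop (𝓝 L) := by
  -- `φhat γ` may vanish only because of finitely many zero factors; starting from an erasure where
  -- it does not vanish leaves the limit unchanged.
  by_cases h : ∃ m, φhat ((diagonalEmbedding hU).erase m γ) ≠ 0
  · obtain ⟨m, hm⟩ := h
    refine ⟨_, (hhat.tendsto_div hU hφ hζ hm).congr' ?_⟩
    filter_upwards [eventually_ge_atTop m] with n hn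
    rw [(diagonalEmbedding hU).erase_erase hn]
  · push Not at h
    exact ⟨0, by simp [h]⟩

end Auxiliary

/-! ### Traces over a character of the direct sum -/

section Twist

variable {G : Type*} [Group G] {H : ℕ → Type*} [∀ n, Group (H n)] {S : Set G}
  {θ : ∀ n, G → H n} (hθ : IsLEFApprox θ) {φ : ∀ n, H n → ℂ}
  (hU : directSum H ≤ diagonalProduct S θ) {ζ φhat : diagonalProduct S θ → ℂ}

theorem tailMap_erase (n : ℕ) (γ : diagonalProduct S θ) :
    hθ.tailMap S ((diagonalEmbedding hU).erase n γ) = hθ.tailMap S γ := by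
  rw [tailMap_eq_iff]
  filter_upwards [eventually_ge_atTop n] with m hm
  have := (diagonalEmbedding hU).coord_erase n γ m
  rwa [if_neg hm.not_gt] at this

theorem eventually_erase_eq {γ δ : diagonalProduct S θ}
    (h : hθ.tailMap S γ = hθ.tailMap S δ) :
    ∀ᶠ n in atTop, (diagonalEmbedding hU).erase n γ = (diagonalEmbedding hU).erase n δ := by
  obtain ⟨N, hN⟩ := eventually_atTop.mp ((tailMap_eq_iff hθ γ δ).mp h)
  filter_upwards [eventually_ge_atTop N] with n hn
  rw [FactorEmbedding.erase_eq_iff]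
  exact fun m hm => hN m (hn.trans hm)

theorem tailMap_incl (n : ℕ) (x : H n) :
    hθ.tailMap S ((diagonalEmbedding hU).incl n x) = 1 := by
  rw [← MonoidHom.mem_ker, tailMap_ker]
  exact mulSingle_mem_directSum n x

/-- The infinite product of moduli is |φhat γ|. Compatibility therefore says that ψ vanishes
wherever the twist cannot see it, which makes the twist injective. -/
theorem isNull_iff (hhat : IsAuxiliary S θ φ φhat) (hφ : ∀ n, IsTrace (φ n)) (τ : G) :
    IsNull S hθ φ τ ↔ ∀ γ, hθ.tailMap S γ = τ → φhat γ = 0 := by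
  refine forall_congr' fun γ => imp_congr_right fun _ => ?_
  have h := hhat.tendsto_norm hφ γ
  simp only [partialTensor, norm_prod] at h
  refine ⟨fun h0 => norm_eq_zero.mp (tendsto_nhds_unique h h0), fun h0 => ?_⟩
  rwa [h0, norm_zero] at h

theorem convex_compatibleTraces : Convex ℝ (compatibleTraces S hθ φ) := by
  intro a ha b hb s t hs ht hst
  refine ⟨convex_Tr ha.1 hb.1 hs ht hst, fun τ hτ => ?_⟩
  simp [ha.2 τ hτ, hb.2 τ hτ]

theorem isCompact_compatibleTraces : IsCompact (compatibleTraces S hθ φ) := by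
  refine isCompact_Tr.of_isClosed_subset ?_ fun ψ hψ => hψ.1
  refine isClosed_Tr.inter (s₂ := {ψ | ∀ τ, IsNull S hθ φ τ → ψ τ = 0}) ?_
  simp only [Set.ofPred_forall]
  exact isClosed_iInter fun τ => isClosed_iInter fun _ =>
    isClosed_eq (by fun_prop) continuous_const

theorem continuous_twist : Continuous (twist S hθ φhat) := by
  refine continuous_pi fun γ => ?_
  change Continuous fun ψ : G → ℂ => φhat γ * ψ (hθ.tailMap S γ)
  fun_prop

theorem twist_injOn (hhat : IsAuxiliary S θ φ φhat) (hφ : ∀ n, IsTrace (φ n)) :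
    Set.InjOn (twist S hθ φhat) (compatibleTraces S hθ φ) := by
  intro ψ₁ h₁ ψ₂ h₂ h
  funext τ
  by_cases hτ : IsNull S hθ φ τ
  · rw [h₁.2 τ hτ, h₂.2 τ hτ]
  · rw [isNull_iff hθ hhat hφ] at hτ
    push Not at hτ
    obtain ⟨γ, rfl, hγ⟩ := hτ
    exact mul_left_cancel₀ hγ (congrFun h γ)

theorem twist_mem_tracesOver [∀ n, Finite (H n)] (hU : directSum H ≤ diagonalProduct S θ)
    (hhat : IsAuxiliary S θ φ φhat) (hφ : ∀ n, φ n ∈ Ch (H n)) {ψ : G → ℂ} (hψ : ψ ∈ Tr G) :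
    twist S hθ φhat ψ ∈ tracesOver S θ φ := by
  refine (mem_tracesOver_iff hU hφ).mpr
    ⟨(hhat.mem_Tr fun n => Ch_subset_Tr (hφ n)).mul (hψ.comp (hθ.tailMap S)), fun n x => ?_⟩
  change φhat _ * ψ _ = _
  rw [tailMap_incl, hψ.normalized, mul_one, hhat.apply_incl (fun n => Ch_subset_Tr (hφ n))]

theorem exists_twist_eq [∀ n, Finite (H n)] (hU : directSum H ≤ diagonalProduct S θ)
    (hsurj : Function.Surjective (hθ.tailMap S)) (hhat : IsAuxiliary S θ φ φhat)
    (hφ : ∀ n, φ n ∈ Ch (H n)) (hζ : ζ ∈ tracesOver S θ φ) :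
    ∃ ψ ∈ compatibleTraces S hθ φ, twist S hθ φhat ψ = ζ := by
  set E := diagonalEmbedding hU with hE
  have hφT : ∀ n, IsTrace (φ n) := fun n => Ch_subset_Tr (hφ n)
  choose L hL using hhat.exists_tendsto hU hφ hζ
  choose s hs using hsurj
  -- Two lifts of the same tail have equal erasures eventually, so the limit does not depend on the
  -- section `s`.
  have hlim : ∀ γ, Tendsto (fun n => ζ (E.erase n γ) * (starRingEnd ℂ) (φhat (E.erase n γ))) atTop
      (𝓝 (L (s (hθ.tailMap S γ)))) := fun γ => by
    refine (hL (s (hθ.tailMap S γ))).congr' ?_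
    filter_upwards [eventually_erase_eq hθ hU (hs (hθ.tailMap S γ))] with n hn
    rw [hn]
  have hprod : IsTrace fun γ => ζ γ * (starRingEnd ℂ) (φhat γ) :=
    hζ.1.mul (hhat.mem_Tr hφT).conj
  refine ⟨fun τ => L (s τ), ⟨⟨fun n g α => ?_, ?_, fun g h => ?_⟩, fun τ hτ => ?_⟩, ?_⟩
  · have h1 : Tendsto (fun m => ∑ i, ∑ j, α i * (starRingEnd ℂ) (α j) *
        (ζ ((E.erase m (s (g j)))⁻¹ * E.erase m (s (g i))) *
          (starRingEnd ℂ) (φhat ((E.erase m (s (g j)))⁻¹ * E.erase m (s (g i))))))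
        atTop (𝓝 (∑ i, ∑ j, α i * (starRingEnd ℂ) (α j) * L (s ((g j)⁻¹ * g i)))) := by
      refine tendsto_finsetSum _ fun i _ => tendsto_finsetSum _ fun j _ => Tendsto.const_mul _ ?_
      have := hlim ((s (g j))⁻¹ * s (g i))
      rw [map_mul, map_inv, hs, hs] at this
      refine this.congr fun m => ?_
      rw [E.erase_mul, E.erase_inv]
    exact ge_of_tendsto' h1 fun m => hprod.posDef n (fun i => E.erase m (s (g i))) α
  · have h1 := hlim 1
    rw [map_one] at h1
    refine tendsto_nhds_unique h1 ?_
    simp only [E.erase_one]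
    rw [hprod.normalized]
    exact tendsto_const_nhds
  · have h1 := hlim ((s h)⁻¹ * s g * s h)
    rw [map_mul, map_mul, map_inv, hs, hs] at h1
    refine tendsto_nhds_unique h1 ((hL (s g)).congr fun m => ?_)
    rw [E.erase_mul, E.erase_mul, E.erase_inv]
    exact (hprod.conjInvariant _ _).symm
  · rw [isNull_iff hθ hhat hφT] at hτ
    refine tendsto_nhds_unique (hL (s τ)) ?_
    have h0 : ∀ n, φhat (E.erase n (s τ)) = 0 := fun n =>
      hτ _ (by rw [hE, tailMap_erase, hs])
    simp only [← hE, h0, map_zero, mul_zero]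
    exact tendsto_const_nhds
  · funext γ
    change φhat γ * L (s (hθ.tailMap S γ)) = ζ γ
    -- At zeros of `φhat`, the bound |ζ| ≤ |φhat| forces ζ to vanish as well.
    by_cases hγ : φhat γ = 0
    · have := hhat.norm_le hφ hU hζ γ
      rw [hγ, norm_zero] at this
      rw [hγ, zero_mul, norm_le_zero_iff.mp this]
    · rw [tendsto_nhds_unique (hlim γ) (hhat.tendsto_div hU hφ hζ hγ), mul_div_cancel₀ _ hγ]

theorem twist_image [∀ n, Finite (H n)] (hU : directSum H ≤ diagonalProduct S θ)
    (hsurj : Function.Surjective (hθ.tailMap S)) (hhat : IsAuxiliary S θ φ φhat)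
    (hφ : ∀ n, φ n ∈ Ch (H n)) :
    twist S hθ φhat '' compatibleTraces S hθ φ = tracesOver S θ φ := by
  refine Set.Subset.antisymm ?_ fun ζ hζ => exists_twist_eq hθ hU hsurj hhat hφ hζ
  rintro _ ⟨ψ, hψ, rfl⟩
  exact twist_mem_tracesOver hθ hU hhat hφ hψ.1

/-- An injective linear map preserves extreme points, and the extreme points of a face are those of
the whole set lying in it. -/
theorem twist_image_characters [∀ n, Finite (H n)] (hU : directSum H ≤ diagonalProduct S θ)
    (hsurj : Function.Surjective (hθ.tailMap S)) (hhat : IsAuxiliary S θ φ φhat)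
    (hφ : ∀ n, φ n ∈ Ch (H n)) :
    twist S hθ φhat '' compatibleCharacters S hθ φ =
      tracesOver S θ φ ∩ Ch (diagonalProduct S θ) := by
  rw [compatibleCharacters, image_extremePoints_of_injOn (convex_compatibleTraces hθ)
    (twist_injOn hθ hhat fun n => Ch_subset_Tr (hφ n)), twist_image hθ hU hsurj hhat hφ,
    (isExtreme_tracesOver hU hφ).extremePoints_eq, Ch]

theorem isEmbedding_twist (hhat : IsAuxiliary S θ φ φhat) (hφ : ∀ n, φ n ∈ Ch (H n)) :
    IsEmbedding fun ψ : compatibleTraces S hθ φ => twist S hθ φhat ψ :=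
  isEmbedding_of_isCompact (continuous_twist hθ)
    (twist_injOn hθ hhat fun n => Ch_subset_Tr (hφ n)) (isCompact_compatibleTraces hθ)

theorem twist_bijOn [∀ n, Finite (H n)] (hU : directSum H ≤ diagonalProduct S θ)
    (hsurj : Function.Surjective (hθ.tailMap S))
    {aux : (∀ n, H n → ℂ) → (diagonalProduct S θ → ℂ)}
    (haux : ∀ φ, (∀ n, φ n ∈ Ch (H n)) → IsAuxiliary S θ φ (aux φ)) :
    Set.BijOn (fun p : (∀ n, H n → ℂ) × (G → ℂ) => twist S hθ (aux p.1) p.2)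
      {p | (∀ n, p.1 n ∈ Ch (H n)) ∧ p.2 ∈ compatibleCharacters S hθ p.1}
      (Ch (diagonalProduct S θ)) := by
  have himage := fun φ (hφ : ∀ n, φ n ∈ Ch (H n)) =>
    twist_image_characters hθ hU hsurj (haux φ hφ) hφ
  refine ⟨?_, ?_, fun ζ hζ => ?_⟩
  · rintro ⟨φ, ψ⟩ ⟨hφ, hψ⟩
    exact ((himage φ hφ).subset ⟨ψ, hψ, rfl⟩).2
  · rintro ⟨φ, ψ⟩ ⟨hφ, hψ⟩ ⟨φ', ψ'⟩ ⟨hφ', hψ'⟩ h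
    dsimp only at h hφ hφ' hψ hψ'
    have h1 := ((himage φ hφ).subset ⟨ψ, hψ, rfl⟩).1.2
    have h2 := ((himage φ' hφ').subset ⟨ψ', hψ', rfl⟩).1.2
    rw [h] at h1
    obtain rfl := (tensor_bijOn hU).injOn hφ hφ' (h1.symm.trans h2)
    rw [twist_injOn hθ (haux φ hφ) (fun n => Ch_subset_Tr (hφ n)) hψ.1 hψ'.1 h]
  · have hφ : ∀ n, (fun x => ζ ((diagonalEmbedding hU).incl n x)) ∈ Ch (H n) :=
      (diagonalEmbedding hU).incl_mem_Ch hζ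
    obtain ⟨ψ, hψ, h⟩ := (himage _ hφ).superset
      ⟨(mem_tracesOver_iff hU hφ).mpr ⟨Ch_subset_Tr hζ, fun _ _ => rfl⟩, hζ⟩
    exact ⟨(_, ψ), ⟨hφ, hψ⟩, h⟩

end Twist

end DiagProd

end

theorem theorem1p4 {G : Type*} [Group G] (S : Set G) (hSfin : S.Finite)
    (hSgen : Subgroup.closure S = ⊤)
    {H : ℕ → Type*} [∀ n, Group (H n)] (θ : ∀ n, G → H n)
    (hθ : DiagProd.IsLEFApprox θ) (hess : DiagProd.IsEssentialBySimple S θ) :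
    -- `t` is onto, its kernel is `U`, and `U` is all of `⊕ H n`
    (Function.Surjective (hθ.tailMap S) ∧
      (hθ.tailMap S).ker = DiagProd.sumSubgroup S θ ∧
      DiagProd.directSum H ≤ DiagProd.diagonalProduct S θ) ∧
    -- every character of `U` is `⊗ φ n` for a unique sequence of characters `φ n` of `H n`
    Set.BijOn (DiagProd.tensor S θ) {φ | ∀ n, φ n ∈ DiagProd.Ch (H n)}
      (DiagProd.Ch (DiagProd.sumSubgroup S θ)) ∧
    -- traces over a fixed character `φ = ⊗ φ n` of `U`
    (∀ φ : ∀ n, H n → ℂ, (∀ n, φ n ∈ DiagProd.Ch (H n)) →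
      (∃ φhat, DiagProd.IsAuxiliary S θ φ φhat) ∧
      ∀ φhat, DiagProd.IsAuxiliary S θ φ φhat →
        φhat ∈ DiagProd.Tr (DiagProd.diagonalProduct S θ) ∧
        DiagProd.RestrictsToHomeomorph (DiagProd.twist S hθ φhat)
          (DiagProd.compatibleTraces S hθ φ) (DiagProd.tracesOver S θ φ) ∧
        DiagProd.RestrictsToHomeomorph (DiagProd.twist S hθ φhat)
          (DiagProd.compatibleCharacters S hθ φ)
          (DiagProd.tracesOver S θ φ ∩ DiagProd.Ch (DiagProd.diagonalProduct S θ))) ∧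
    -- characters of the diagonal product, for every choice of auxiliary traces
    (∀ aux : (∀ n, H n → ℂ) → (DiagProd.diagonalProduct S θ → ℂ),
      (∀ φ, (∀ n, φ n ∈ DiagProd.Ch (H n)) → DiagProd.IsAuxiliary S θ φ (aux φ)) →
      Set.BijOn
        (fun p : (∀ n, H n → ℂ) × (G → ℂ) => DiagProd.twist S hθ (aux p.1) p.2)
        {p | (∀ n, p.1 n ∈ DiagProd.Ch (H n)) ∧ p.2 ∈ DiagProd.compatibleCharacters S hθ p.1}
        (DiagProd.Ch (DiagProd.diagonalProduct S θ))) := by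
  have hfin := hθ.finite
  have hsurj := DiagProd.tailMap_surjective hθ hSgen
  have hU := DiagProd.directSum_le hθ hSgen hess
  refine ⟨⟨hsurj, DiagProd.tailMap_ker hθ, hU⟩, DiagProd.tensor_bijOn hU, fun φ hφ =>
    ⟨DiagProd.exists_isAuxiliary fun n => DiagProd.Ch_subset_Tr (hφ n), fun φhat hhat =>
      ⟨hhat.mem_Tr fun n => DiagProd.Ch_subset_Tr (hφ n), ?_, ?_⟩⟩,
    fun aux haux => DiagProd.twist_bijOn hθ hU hsurj haux⟩
  · rw [← DiagProd.twist_image hθ hU hsurj hhat hφ]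
    exact DiagProd.restrictsToHomeomorph_image (DiagProd.isEmbedding_twist hθ hhat hφ)
  · rw [← DiagProd.twist_image_characters hθ hU hsurj hhat hφ]
    -- The extreme points need not form a compact set, so the embedding is inherited from the
    -- compact set of compatible traces.
    exact DiagProd.restrictsToHomeomorph_image (DiagProd.isEmbedding_of_subset
      (DiagProd.isEmbedding_twist hθ hhat hφ) extremePoints_subset)
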